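/- Let $\mathbb{F}\in\{\mathbb{R},\mathbb{C}\}$ and $0<p\leqslant 1$. A $p$-Banach space is a complete space $X$ over $\mathbb{F}$ with a positive definite, absolutely homogeneous function $\|\cdot\|$ such that $\|x+y\|^p\leqslant\|x\|^p+\|y\|^p$; $X^*$ is the space of continuous linear functionals $f:X\to\mathbb{F}$, with $\|f\|=\sup_{\|x\|\leqslant 1}|f(x)|$. A basis of a separable, infinite-dimensional $p$-Banach space $X$ is a sequence $\mathcal{B}=(e_n)_{n\geqslant 1}$ in $X$ with dense linear span for which there is a unique sequence $(e_n^*)_{n\geqslant 1}$ in $X^*$ with $e_m^*(e_n)=\delta_{m,n}$, and such that $0<\inf_n\{\|e_n\|,\|e_n^*\|\}\leqslant\sup_n\{\|e_n\|,\|e_n^*\|\}<\infty$. For a finite $A\subset\mathbb{N}=\{1,2,\dots\}$ put $P_A(x)=\sum_{n\in A}e_n^*(x)e_n$. A greedy sum $G_m(x)$ is any vector $P_\Lambda(x)$ with $|\Lambda|=m$ and $|e_n^*(x)|\geqslant|e_k^*(x)|$ for all $n\in\Lambda$, $k\notin\Lambda$. The basis is almost greedy if there is $C>0$ such that $\|x-G_m(x)\|\leqslant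 C\inf\{\|x-P_A(x)\|:|A|=m\}$ for all $x\in X$, all $m$ and all $G_m(x)$. For a nonempty family $\mathcal{F}$ of finite subsets of $\mathbb{N}$ it is $\mathcal{F}$-almost greedy if there is $\Delta\geqslant 1$ such that $\|x-G_m(x)\|\leqslant\Delta\inf\{\|x-P_F(x)\|:F\in\mathcal{F},\ |F|\leqslant m\}$ for all $x\in X$, all $m\geqslant\min_{F\in\mathcal{F}}|F|$ and all $G_m(x)$. It is quasi-greedy if there is $C>0$ such that $\|x-G_m(x)\|\leqslant C\|x\|$ for all $x$, $m$ and $G_m(x)$. It is a Schauder basis if the span of $(e_n^*)_n$ is weak-* dense in $X^*$ and $\|\sum_{n=1}^m e_n^*(x)e_n\|\leqslant C\|x\|$ for all $x$, $m$ and some constant $C>0$. It is unconditional if for every $x\in X$ the series $\sum_n e_n^*(x)e_n$ converges unconditionally to $x$, and conditional otherwise. For a sequence $(a_n)_{n\geqslant 1}$ of positive integers let $$\mathcal{F}_{(a_n)}=\{\emptyset\}\cup\big\{k+\{a_1,\,a_1+a_2,\,\dots,\,a_1+\cdots+a_\ell\}:k\geqslant 0,\ \ell\geqslant 1\big\}.$$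 **Theorem.** Let $(a_n)_{n\geqslant 1}$ be a sequence of positive integers. For each choice of $\mathbb{F}$ and $p$ as above, the following are equivalent: 1. The sequence $(a_n)$ is bounded. 2. For every separable, infinite-dimensional $p$-Banach space over $\mathbb{F}$ and every basis of it, the basis is $\mathcal{F}_{(a_n)}$-almost greedy if and only if it is almost greedy. Moreover, if $(a_n)$ is unbounded, there is a separable, infinite-dimensional Banach space over $\mathbb{F}$ with a conditional, quasi-greedy Schauder basis that is $\mathcal{F}_{(a_n)}$-almost greedy but not almost greedy. -/

import Mathlib

universe u v

noncomputable section

namespace SeqGreedy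

/-- `X`, with the function `‖·‖`, is a `p`-normed space over `𝕜`: `‖·‖` is positive definite,
absolutely homogeneous and `p`-subadditive, and the uniform structure of `X` (hence its topology,
its Cauchy filters, its continuous functionals) is the one given by the entourages
`{(x, y) | ‖x - y‖ < ε}`, `ε > 0`.  A `p`-Banach space is a complete `p`-normed space.
For `p = 1` these are the normed (Banach) spaces. -/
class PNormedSpace (p : ℝ) (𝕜 : Type v) (X : Type u) [RCLike 𝕜] [AddCommGroup X] [Module 𝕜 X]
    [UniformSpace X] [Norm X] : Prop where
  norm_nonneg : ∀ x : X, 0 ≤ ‖x‖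
  norm_eq_zero_iff : ∀ x : X, ‖x‖ = 0 ↔ x = 0
  norm_smul : ∀ (c : 𝕜) (x : X), ‖c • x‖ = ‖c‖ * ‖x‖
  norm_add_rpow_le : ∀ x y : X, ‖x + y‖ ^ p ≤ ‖x‖ ^ p + ‖y‖ ^ p
  uniformity_hasBasis :
    (uniformity X).HasBasis (fun ε : ℝ => 0 < ε) (fun ε => {q : X × X | ‖q.1 - q.2‖ < ε})

section Bases

variable {𝕜 : Type v} {X : Type u} [RCLike 𝕜] [AddCommGroup X] [Module 𝕜 X]
  [UniformSpace X] [Norm X]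

/-- The norm of a continuous functional: its supremum in modulus over the unit ball. -/
def dualNorm (f : X →L[𝕜] 𝕜) : ℝ := sSup {r : ℝ | ∃ x : X, ‖x‖ ≤ 1 ∧ r = ‖f x‖}

variable (𝕜 X) in
/-- A basis of `X`, with its biorthogonal functionals.  Sequences are indexed by `ℕ` starting at
`0`: `vec n` and `coord n` stand for the vector `e_{n+1}` and the functional `e^*_{n+1}`. -/
structure GBasis where
  /-- the vectors of the basis -/
  vec : ℕ → X
  /-- the biorthogonal functionals -/
  coord : ℕ → (X →L[𝕜] 𝕜)
  dense_span : Dense (Submodule.span 𝕜 (Set.range vec) : Set X)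
  biorthogonal : ∀ m n, coord m (vec n) = if m = n then 1 else 0
  coord_unique : ∀ g : ℕ → (X →L[𝕜] 𝕜),
    (∀ m n, g m (vec n) = if m = n then 1 else 0) → g = coord
  seminormalized : ∃ c₁ c₂ : ℝ, 0 < c₁ ∧
    ∀ n, (c₁ ≤ ‖vec n‖ ∧ ‖vec n‖ ≤ c₂) ∧ (c₁ ≤ dualNorm (coord n) ∧ dualNorm (coord n) ≤ c₂)

/-- The projection `P_A x = ∑_{n ∈ A} e_n^*(x) e_n`. -/
def GBasis.proj (B : GBasis 𝕜 X) (A : Finset ℕ) (x : X) : X := ∑ n ∈ A, B.coord n x • B.vec n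

/-- `Λ` is an admissible greedy set for `x`: each coefficient of `x` with index in `Λ` is at least
as large in modulus as each coefficient with index outside `Λ`.  The greedy sums `G_m x` are the
vectors `P_Λ x`, for greedy sets `Λ` of cardinality `m`. -/
def GBasis.IsGreedySet (B : GBasis 𝕜 X) (x : X) (Λ : Finset ℕ) : Prop :=
  ∀ n ∈ Λ, ∀ k, k ∉ Λ → ‖B.coord k x‖ ≤ ‖B.coord n x‖

/-- The least error `inf {‖x - P_A x‖ : |A| = m}` of projections onto `m` basis vectors. -/
def GBasis.projError (B : GBasis 𝕜 X) (m : ℕ) (x : X) : ℝ :=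
  sInf {r : ℝ | ∃ A : Finset ℕ, A.card = m ∧ r = ‖x - B.proj A x‖}

def GBasis.AlmostGreedy (B : GBasis 𝕜 X) : Prop :=
  ∃ C : ℝ, 0 < C ∧ ∀ (x : X) (m : ℕ) (Λ : Finset ℕ), Λ.card = m → B.IsGreedySet x Λ →
    ‖x - B.proj Λ x‖ ≤ C * B.projError m x

/-- The least cardinality of a member of `𝓕`. -/
def minCard (𝓕 : Set (Finset ℕ)) : ℕ := sInf (Finset.card '' 𝓕)

/-- The least error `inf {‖x - P_F x‖ : F ∈ 𝓕, |F| ≤ m}`. -/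
def GBasis.familyError (B : GBasis 𝕜 X) (𝓕 : Set (Finset ℕ)) (m : ℕ) (x : X) : ℝ :=
  sInf {r : ℝ | ∃ F ∈ 𝓕, F.card ≤ m ∧ r = ‖x - B.proj F x‖}

def GBasis.FamilyAlmostGreedy (B : GBasis 𝕜 X) (𝓕 : Set (Finset ℕ)) : Prop :=
  ∃ Δ : ℝ, 1 ≤ Δ ∧ ∀ (x : X) (m : ℕ), minCard 𝓕 ≤ m →
    ∀ Λ : Finset ℕ, Λ.card = m → B.IsGreedySet x Λ →
      ‖x - B.proj Λ x‖ ≤ Δ * B.familyError 𝓕 m x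

/-- (Suppression) quasi-greedy. -/
def GBasis.QuasiGreedy (B : GBasis 𝕜 X) : Prop :=
  ∃ C : ℝ, 0 < C ∧ ∀ (x : X) (Λ : Finset ℕ), B.IsGreedySet x Λ → ‖x - B.proj Λ x‖ ≤ C * ‖x‖

/-- The functionals `e_n^*` span a weak-* dense subspace of the dual. -/
def GBasis.IsMarkushevich (B : GBasis 𝕜 X) : Prop :=
  Dense (Submodule.span 𝕜 (Set.range fun n => (StrongDual.toWeakDual (B.coord n))) :
    Set (WeakDual 𝕜 X))

/-- A Markushevich basis with uniformly bounded partial sum operators. -/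
def GBasis.IsSchauder (B : GBasis 𝕜 X) : Prop :=
  B.IsMarkushevich ∧
    ∃ C : ℝ, 0 < C ∧ ∀ (x : X) (m : ℕ), ‖B.proj (Finset.range m) x‖ ≤ C * ‖x‖

/-- Every `x` is the sum of the unconditionally convergent series `∑ e_n^*(x) e_n`
(`HasSum` is convergence along the net of all finite sets of indices). -/
def GBasis.IsUnconditional (B : GBasis 𝕜 X) : Prop :=
  ∀ x : X, HasSum (fun n => B.coord n x • B.vec n) x

/-- Conditional means: not unconditional. -/
def GBasis.IsConditional (B : GBasis 𝕜 X) : Prop := ¬ B.IsUnconditional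

end Bases

/-- The family consisting of `∅` and of the sets `k + {a_1, a_1 + a_2, …, a_1 + ⋯ + a_ℓ}`, `k ≥ 0`,
`ℓ ≥ 1`.  Here `a i` stands for `a_{i+1}`, and, as the basis is indexed from `0`, each set is
written through its zero-based indices, that is, with `1` subtracted from all its elements
(the subtraction is exact for positive `a_1`). -/
def gapFamily (a : ℕ → ℕ) : Set (Finset ℕ) :=
  {A | A = ∅ ∨ ∃ k ℓ : ℕ, 1 ≤ ℓ ∧
    A = (Finset.range ℓ).image fun j => (k + ∑ i ∈ Finset.range (j + 1), a i) - 1}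

end SeqGreedy

end

open SeqGreedy

/-! Almost greedy always implies family-almost greedy: a member `F` with fewer than `m` elements is
padded by indices so far out that the added projection is negligible, because the coefficients of a
fixed vector tend to `0`.

Suppose the gaps are bounded by `M`. Let `Λ` be greedy for `x`, let `|A| = |Λ|`, and put `y = x -
P_A x`. Then `x - P_Λ x = (y - P_{Λ \ A} y) + P_{A \ Λ} x`. The first term is controlled by
comparison with `∅`. For the second, let `α` be the least coefficient modulus of `y` on `Λ \ A`; it
bounds the coefficients of `x` on `A \ Λ`. Up to finitely many small indices, `M` translates of the
pattern cover `A \ Λ` (`exists_mem_gapSet`). Each resulting piece lies in a member of the family, so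
it is dominated by the flat vector `α 1_D` on a far-away member `D` of size `|Λ \ A|`
(`norm_proj_le_flat`). In turn `flat_rpow_le` dominates `α 1_D` by `y`.

Suppose the gaps are unbounded. Some infinite set `S` meets every member of the family in at most
one point (`exists_infinite_subsingleton_inter`). Take the maximum of the sup norm, the `ℓ₂` norm on
`S`, and the supremum of the partial sums along `S` weighted by `1/√j`. Projections onto parts of
members see only the sup norm, so once quasi-greediness is known (`norm_proj_le_four_mul`) the basis
is family-almost greedy. Flat vectors on `S` and off `S` have incomparable norms, which refutes
almost greediness. The weighted sums make the basis conditional: alternating signs cancel, while the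
positive part alone sums like the harmonic series. -/

namespace SeqGreedy

/-! ### Coordinate projections and greedy sets. -/

section Basis

variable {𝕜 : Type v} {X : Type u} [RCLike 𝕜] [AddCommGroup X] [Module 𝕜 X]
  [UniformSpace X] [Norm X]

namespace GBasis

theorem coord_sum_smul (B : GBasis 𝕜 X) (T : Finset ℕ) (b : ℕ → 𝕜) (m : ℕ) :
    B.coord m (∑ n ∈ T, b n • B.vec n) = if m ∈ T then b m else 0 := by
  simp [map_sum, B.biorthogonal]

theorem coord_proj (B : GBasis 𝕜 X) (A : Finset ℕ) (x : X) (m : ℕ) :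
    B.coord m (B.proj A x) = if m ∈ A then B.coord m x else 0 :=
  B.coord_sum_smul A (fun n => B.coord n x) m

theorem proj_congr (B : GBasis 𝕜 X) {A : Finset ℕ} {x y : X}
    (h : ∀ n ∈ A, B.coord n x = B.coord n y) : B.proj A x = B.proj A y :=
  Finset.sum_congr rfl fun n hn => by rw [h n hn]

theorem proj_sum_smul (B : GBasis 𝕜 X) (A T : Finset ℕ) (b : ℕ → 𝕜) :
    B.proj A (∑ n ∈ T, b n • B.vec n) = ∑ n ∈ A ∩ T, b n • B.vec n := by
  simp only [proj, coord_sum_smul, ite_smul, zero_smul, Finset.sum_ite_mem]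

@[simp] theorem proj_empty (B : GBasis 𝕜 X) (x : X) : B.proj ∅ x = 0 := by
  simp [proj]

@[simp] theorem proj_zero (B : GBasis 𝕜 X) (A : Finset ℕ) : B.proj A 0 = 0 := by
  simp [proj]

theorem proj_union (B : GBasis 𝕜 X) {A A' : Finset ℕ} (h : Disjoint A A') (x : X) :
    B.proj (A ∪ A') x = B.proj A x + B.proj A' x :=
  Finset.sum_union h

theorem proj_sdiff_add_proj_inter (B : GBasis 𝕜 X) (A A' : Finset ℕ) (x : X) :
    B.proj (A \ A') x + B.proj (A ∩ A') x = B.proj A x := by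
  rw [← B.proj_union (Finset.disjoint_sdiff_inter A A'), Finset.sdiff_union_inter]

/-- Replacing the projection onto `A` by the projection onto `Λ`. -/
theorem sub_proj_eq (B : GBasis 𝕜 X) (A Λ : Finset ℕ) (x : X) :
    x - B.proj Λ x = (x - B.proj A x - B.proj (Λ \ A) (x - B.proj A x)) + B.proj (A \ Λ) x := by
  have h1 : B.proj (Λ \ A) (x - B.proj A x) = B.proj (Λ \ A) x := by
    refine B.proj_congr fun n hn => ?_
    simp [coord_proj, (Finset.mem_sdiff.1 hn).2]
  rw [h1, ← B.proj_sdiff_add_proj_inter Λ A, ← B.proj_sdiff_add_proj_inter A Λ,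
    Finset.inter_comm A Λ]
  abel

theorem IsGreedySet.sdiff {B : GBasis 𝕜 X} {x : X} {Λ : Finset ℕ} (h : B.IsGreedySet x Λ)
    (A : Finset ℕ) : B.IsGreedySet (x - B.proj A x) (Λ \ A) := by
  intro n hn k hk
  obtain ⟨hnΛ, hnA⟩ := Finset.mem_sdiff.1 hn
  by_cases hkA : k ∈ A
  · simp [coord_proj, hkA]
  · have : k ∉ Λ := fun hk' => hk (Finset.mem_sdiff.2 ⟨hk', hkA⟩)
    simpa [coord_proj, hkA, hnA] using h n hnΛ k this

end GBasis

end Basis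

/-! ### Estimates in `p`-normed spaces; decay of coefficients. -/

namespace PNormedSpace

section Norm

variable (p : ℝ) (𝕜 : Type v) {X : Type u} [RCLike 𝕜] [AddCommGroup X] [Module 𝕜 X]
  [UniformSpace X] [Norm X] [PNormedSpace p 𝕜 X]

include p 𝕜

theorem norm_zero' : ‖(0 : X)‖ = 0 := (norm_eq_zero_iff p 𝕜 0).2 rfl

theorem norm_neg' (x : X) : ‖-x‖ = ‖x‖ := by
  have := norm_smul p (-1 : 𝕜) x
  simpa using this

theorem norm_sub_rpow_le (x y : X) : ‖x - y‖ ^ p ≤ ‖x‖ ^ p + ‖y‖ ^ p := by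
  have := norm_add_rpow_le (p := p) 𝕜 x (-y)
  rwa [norm_neg' p 𝕜, ← sub_eq_add_neg] at this

theorem norm_sum_rpow_le (hp : 0 < p) {ι : Type*} (s : Finset ι) (f : ι → X) :
    ‖∑ i ∈ s, f i‖ ^ p ≤ ∑ i ∈ s, ‖f i‖ ^ p := by
  classical
  induction s using Finset.induction_on with
  | empty => simp [norm_zero' p 𝕜, Real.zero_rpow hp.ne']
  | insert a s ha ih =>
    rw [Finset.sum_insert ha, Finset.sum_insert ha]
    exact (norm_add_rpow_le 𝕜 _ _).trans (by gcongr)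

theorem le_mul_of_rpow_le (hp : 0 < p) {C : ℝ} (hC : 0 ≤ C) {x y : X}
    (h : ‖x‖ ^ p ≤ C * ‖y‖ ^ p) : ‖x‖ ≤ C ^ p⁻¹ * ‖y‖ := by
  have hy := norm_nonneg p 𝕜 y
  rw [← Real.rpow_le_rpow_iff (norm_nonneg p 𝕜 x) (by positivity) hp,
    Real.mul_rpow (by positivity) hy, Real.rpow_inv_rpow hC hp.ne']
  exact h

theorem nhds_zero_hasBasis :
    (nhds (0 : X)).HasBasis (fun ε : ℝ => 0 < ε) (fun ε => {y | ‖y‖ < ε}) := by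
  simpa using nhds_basis_uniformity (uniformity_hasBasis p 𝕜 (X := X)) (x := 0)

theorem exists_norm_le_mul (f : X →L[𝕜] 𝕜) : ∃ K : ℝ, ∀ x : X, ‖f x‖ ≤ K * ‖x‖ := by
  have h0 : {y : 𝕜 | ‖y‖ < 1} ∈ nhds (f 0) := by
    rw [map_zero]
    simpa [Metric.ball] using Metric.ball_mem_nhds (0 : 𝕜) one_pos
  obtain ⟨δ, hδ, h⟩ := (nhds_zero_hasBasis p 𝕜).mem_iff.1 (f.continuous.continuousAt h0)
  refine ⟨2 / δ, fun x => ?_⟩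
  rcases eq_or_ne x 0 with rfl | hx
  · simp [norm_zero' p 𝕜]
  have hx' : 0 < ‖x‖ := lt_of_le_of_ne (norm_nonneg p 𝕜 x)
    fun h => hx ((norm_eq_zero_iff p 𝕜 x).1 h.symm)
  have hc : ‖((δ / (2 * ‖x‖) : ℝ) : 𝕜)‖ = δ / (2 * ‖x‖) := by
    rw [RCLike.norm_ofReal, abs_of_pos (by positivity)]
  have h1 : ‖((δ / (2 * ‖x‖) : ℝ) : 𝕜) • x‖ < δ := by
    rw [norm_smul p, hc]
    field_simp
    linarith
  have h2 : ‖f (((δ / (2 * ‖x‖) : ℝ) : 𝕜) • x)‖ < 1 := h h1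
  rw [map_smul, smul_eq_mul, norm_mul, hc] at h2
  rw [div_mul_eq_mul_div, le_div_iff₀ hδ]
  rw [div_mul_eq_mul_div, div_lt_one (by positivity)] at h2
  linarith

/-- A real `sSup` is `0` on unbounded sets, so `dualNorm` is meaningful only once continuity has
bounded the functional on the unit ball. -/
theorem norm_le_dualNorm_mul (f : X →L[𝕜] 𝕜) (x : X) : ‖f x‖ ≤ dualNorm f * ‖x‖ := by
  obtain ⟨K, hK⟩ := exists_norm_le_mul p 𝕜 f
  rcases eq_or_ne x 0 with rfl | hx
  · simp [norm_zero' p 𝕜]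
  have hx' : 0 < ‖x‖ := lt_of_le_of_ne (norm_nonneg p 𝕜 x)
    fun h => hx ((norm_eq_zero_iff p 𝕜 x).1 h.symm)
  have hbdd : BddAbove {r : ℝ | ∃ x : X, ‖x‖ ≤ 1 ∧ r = ‖f x‖} := by
    refine ⟨|K|, ?_⟩
    rintro r ⟨y, hy, rfl⟩
    have := norm_nonneg p 𝕜 y
    calc ‖f y‖ ≤ K * ‖y‖ := hK y
      _ ≤ |K| * ‖y‖ := by gcongr; exact le_abs_self K
      _ ≤ |K| * 1 := by gcongr
      _ = |K| := mul_one _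
  have hc : ‖((‖x‖⁻¹ : ℝ) : 𝕜)‖ = ‖x‖⁻¹ := by
    rw [RCLike.norm_ofReal, abs_of_pos (by positivity)]
  have h1 : ‖((‖x‖⁻¹ : ℝ) : 𝕜) • x‖ ≤ 1 := by
    rw [norm_smul p, hc, inv_mul_cancel₀ hx'.ne']
  have h2 := le_csSup hbdd ⟨_, h1, rfl⟩
  rw [map_smul, smul_eq_mul, norm_mul, hc, inv_mul_le_iff₀ hx', mul_comm] at h2
  exact h2

theorem exists_coord_le_mul (B : GBasis 𝕜 X) :
    ∃ K : ℝ, 0 < K ∧ (∀ n, ‖B.vec n‖ ≤ K) ∧ ∀ n (x : X), ‖B.coord n x‖ ≤ K * ‖x‖ := by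
  obtain ⟨c₁, c₂, hc, h⟩ := B.seminormalized
  refine ⟨c₂, hc.trans_le ((h 0).1.1.trans (h 0).1.2), fun n => (h n).1.2, fun n x => ?_⟩
  have := norm_nonneg p 𝕜 x
  exact (norm_le_dualNorm_mul p 𝕜 _ x).trans (by gcongr; exact (h n).2.2)

/-- True with eventual value `0` on the dense span, and the functionals are uniformly bounded. -/
theorem exists_forall_norm_coord_lt (B : GBasis 𝕜 X) (x : X) {ε : ℝ} (hε : 0 < ε) :
    ∃ N, ∀ n, N ≤ n → ‖B.coord n x‖ < ε := by
  obtain ⟨K, hK, -, hcoord⟩ := exists_coord_le_mul p 𝕜 B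
  obtain ⟨z, hz, hzs⟩ := mem_closure_iff_nhds.1 (B.dense_span x) _
    ((nhds_basis_uniformity (uniformity_hasBasis p 𝕜 (X := X))).mem_of_mem
      (show 0 < ε / K by positivity))
  have hvan : ∃ N, ∀ n, N ≤ n → B.coord n z = 0 := by
    refine Submodule.span_induction (p := fun z _ => ∃ N, ∀ n, N ≤ n → B.coord n z = 0)
      ?_ ⟨0, by simp⟩ ?_ ?_ hzs
    · rintro _ ⟨m, rfl⟩
      exact ⟨m + 1, fun n hn => by rw [B.biorthogonal, if_neg (by omega)]⟩
    · rintro y z - - ⟨N, hN⟩ ⟨M, hM⟩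
      exact ⟨max N M, fun n hn => by
        rw [map_add, hN n (le_of_max_le_left hn), hM n (le_of_max_le_right hn), add_zero]⟩
    · rintro c y - ⟨N, hN⟩
      exact ⟨N, fun n hn => by rw [map_smul, hN n hn, smul_zero]⟩
  obtain ⟨N, hN⟩ := hvan
  refine ⟨N, fun n hn => ?_⟩
  have h1 := hcoord n (z - x)
  rw [map_sub, hN n hn, zero_sub, norm_neg] at h1
  refine h1.trans_lt ?_
  rw [mul_comm, ← lt_div_iff₀ hK]
  exact hz

theorem exists_forall_proj_rpow_le (hp : 0 < p) (B : GBasis 𝕜 X) (x : X) (m : ℕ) {ε : ℝ}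
    (hε : 0 < ε) :
    ∃ N, ∀ D : Finset ℕ, D.card ≤ m → (∀ n ∈ D, N ≤ n) → ‖B.proj D x‖ ^ p ≤ ε := by
  obtain ⟨K, hK, hvec, -⟩ := exists_coord_le_mul p 𝕜 B
  -- Chosen so that each of at most `m` terms contributes at most `(δ K)^p = ε / (m + 1)`.
  set δ : ℝ := (ε / (m + 1)) ^ p⁻¹ / K with hδ
  have hδ0 : 0 < δ := by positivity
  obtain ⟨N, hN⟩ := exists_forall_norm_coord_lt p 𝕜 B x hδ0
  refine ⟨N, fun D hD hDN => (norm_sum_rpow_le p 𝕜 hp D _).trans ?_⟩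
  have hterm : ∀ n ∈ D, ‖B.coord n x • B.vec n‖ ^ p ≤ ε / (m + 1) := by
    intro n hn
    have h0 := norm_nonneg p 𝕜 (B.vec n)
    calc ‖B.coord n x • B.vec n‖ ^ p = (‖B.coord n x‖ * ‖B.vec n‖) ^ p := by rw [norm_smul p]
      _ ≤ (δ * K) ^ p := by
        gcongr
        · exact (hN n (hDN n hn)).le
        · exact hvec n
      _ = ε / (m + 1) := by
        rw [hδ, div_mul_cancel₀ _ hK.ne', Real.rpow_inv_rpow (by positivity) hp.ne']
  calc ∑ n ∈ D, ‖B.coord n x • B.vec n‖ ^ p ≤ D.card • (ε / (m + 1)) :=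
        Finset.sum_le_card_nsmul _ _ _ hterm
    _ ≤ (m + 1) * (ε / (m + 1)) := by
        rw [nsmul_eq_mul]
        gcongr
        exact_mod_cast hD.trans (Nat.le_succ m)
    _ = ε := by field_simp

theorem exists_forall_proj_le (hp : 0 < p) (B : GBasis 𝕜 X) (x : X) (m : ℕ) :
    ∃ N, ∀ D : Finset ℕ, D.card ≤ m → (∀ n ∈ D, N ≤ n) → ‖B.proj D x‖ ≤ ‖x‖ := by
  rcases eq_or_ne x 0 with rfl | hx
  · exact ⟨0, fun D _ _ => by rw [B.proj_zero]⟩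
  have hx' : 0 < ‖x‖ := lt_of_le_of_ne (norm_nonneg p 𝕜 x)
    fun h => hx ((norm_eq_zero_iff p 𝕜 x).1 h.symm)
  obtain ⟨N, hN⟩ := exists_forall_proj_rpow_le p 𝕜 hp B x m (Real.rpow_pos_of_pos hx' p)
  exact ⟨N, fun D hD hDN => (Real.rpow_le_rpow_iff (norm_nonneg p 𝕜 _) hx'.le hp).1 (hN D hD hDN)⟩

theorem projError_le (B : GBasis 𝕜 X) (x : X) (A : Finset ℕ) :
    B.projError A.card x ≤ ‖x - B.proj A x‖ :=
  csInf_le ⟨0, by rintro r ⟨A, -, rfl⟩; exact norm_nonneg p 𝕜 _⟩ ⟨A, rfl, rfl⟩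

theorem familyError_le (B : GBasis 𝕜 X) {𝓕 : Set (Finset ℕ)} (x : X) {F : Finset ℕ} (hF : F ∈ 𝓕)
    {m : ℕ} (hm : F.card ≤ m) : B.familyError 𝓕 m x ≤ ‖x - B.proj F x‖ :=
  csInf_le ⟨0, by rintro r ⟨A, -, -, rfl⟩; exact norm_nonneg p 𝕜 _⟩ ⟨F, hF, hm, rfl⟩

end Norm

end PNormedSpace

/-! ### From almost greedy to family-almost greedy. -/

section Families

variable {𝕜 : Type v} {X : Type u} [RCLike 𝕜] [AddCommGroup X] [Module 𝕜 X]
  [UniformSpace X] [Norm X]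

theorem le_mul_csInf {s : Set ℝ} (hs : s.Nonempty) {C a : ℝ} (hC : 0 < C)
    (h : ∀ r ∈ s, a ≤ C * r) : a ≤ C * sInf s := by
  rw [← div_le_iff₀' hC]
  exact le_csInf hs fun r hr => (div_le_iff₀' hC).2 (h r hr)

theorem minCard_eq_zero {𝓕 : Set (Finset ℕ)} (h : ∅ ∈ 𝓕) : minCard 𝓕 = 0 :=
  Nat.sInf_eq_zero.2 (Or.inl ⟨∅, h, rfl⟩)

theorem GBasis.FamilyAlmostGreedy.of_forall_le {B : GBasis 𝕜 X} {𝓕 : Set (Finset ℕ)}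
    (h𝓕 : ∅ ∈ 𝓕) {Δ : ℝ} (hΔ : 1 ≤ Δ)
    (h : ∀ (x : X) (Λ : Finset ℕ), B.IsGreedySet x Λ → ∀ F ∈ 𝓕, F.card ≤ Λ.card →
      ‖x - B.proj Λ x‖ ≤ Δ * ‖x - B.proj F x‖) : B.FamilyAlmostGreedy 𝓕 := by
  refine ⟨Δ, hΔ, ?_⟩
  rintro x _ - Λ rfl hΛ
  refine le_mul_csInf ?_ (one_pos.trans_le hΔ) ?_
  · exact ⟨_, ∅, h𝓕, by simp, rfl⟩
  rintro _ ⟨F, hF, hc, rfl⟩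
  exact h x Λ hΛ F hF hc

theorem GBasis.AlmostGreedy.of_forall_le {B : GBasis 𝕜 X} {C : ℝ} (hC : 0 < C)
    (h : ∀ (x : X) (Λ : Finset ℕ), B.IsGreedySet x Λ → ∀ A : Finset ℕ, A.card = Λ.card →
      ‖x - B.proj Λ x‖ ≤ C * ‖x - B.proj A x‖) : B.AlmostGreedy := by
  refine ⟨C, hC, ?_⟩
  rintro x _ Λ rfl hΛ
  refine le_mul_csInf ?_ hC ?_
  · exact ⟨_, Λ, rfl, rfl⟩
  rintro _ ⟨A, hA, rfl⟩
  exact h x Λ hΛ A hA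

variable (p : ℝ) [PNormedSpace p 𝕜 X]

include p

open PNormedSpace

theorem GBasis.AlmostGreedy.familyAlmostGreedy (hp : 0 < p) {B : GBasis 𝕜 X}
    (hB : B.AlmostGreedy) {𝓕 : Set (Finset ℕ)} (h𝓕 : ∅ ∈ 𝓕) : B.FamilyAlmostGreedy 𝓕 := by
  obtain ⟨C, hC, h⟩ := hB
  refine .of_forall_le h𝓕 (le_max_right C 1) fun x Λ hΛ F _ hFc => ?_
  have hmain : ‖x - B.proj Λ x‖ ≤ C * ‖x - B.proj F x‖ := by
    have hn := norm_nonneg p 𝕜 (x - B.proj F x)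
    rw [← Real.rpow_le_rpow_iff (norm_nonneg p 𝕜 _) (by positivity) hp,
      Real.mul_rpow hC.le hn]
    refine le_of_forall_pos_le_add fun ε hε => ?_
    obtain ⟨N, hN⟩ := exists_forall_proj_rpow_le p 𝕜 hp B x (Λ.card - F.card)
      (ε := ε / C ^ p) (by positivity)
    -- The padding `D` starts beyond `F`, to be disjoint from it, and beyond `N`, to make `P_D x`
    -- negligible.
    set N' := max N (F.sup id + 1)
    set D := Finset.Ico N' (N' + (Λ.card - F.card))
    have hDc : D.card = Λ.card - F.card := by simp [D]
    have hDN : ∀ n ∈ D, N' ≤ n := fun n hn => (Finset.mem_Ico.1 hn).1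
    have hdisj : Disjoint F D := by
      refine Finset.disjoint_left.2 fun n hnF hnD => ?_
      have h1 : n ≤ F.sup id := Finset.le_sup (f := id) hnF
      have h2 := hDN n hnD
      have h3 : F.sup id + 1 ≤ N' := le_max_right _ _
      omega
    have hcard : (F ∪ D).card = Λ.card := by
      rw [Finset.card_union_of_disjoint hdisj, hDc]; omega
    have h1 := (h x Λ.card Λ rfl hΛ).trans
      (mul_le_mul_of_nonneg_left (hcard ▸ projError_le p 𝕜 B x (F ∪ D)) hC.le)
    have h2 := hN D hDc.le fun n hn => (le_max_left _ _).trans (hDN n hn)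
    have hn' := norm_nonneg p 𝕜 (x - B.proj (F ∪ D) x)
    calc ‖x - B.proj Λ x‖ ^ p ≤ (C * ‖x - B.proj (F ∪ D) x‖) ^ p :=
          Real.rpow_le_rpow (norm_nonneg p 𝕜 _) h1 hp.le
      _ = C ^ p * ‖(x - B.proj F x) - B.proj D x‖ ^ p := by
          rw [Real.mul_rpow hC.le hn', B.proj_union hdisj, sub_add_eq_sub_sub]
      _ ≤ C ^ p * (‖x - B.proj F x‖ ^ p + ε / C ^ p) := by
          gcongr
          exact (norm_sub_rpow_le p 𝕜 _ _).trans (by gcongr)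
      _ = C ^ p * ‖x - B.proj F x‖ ^ p + ε := by
          have : C ^ p ≠ 0 := (Real.rpow_pos_of_pos hC p).ne'
          field_simp
  have := norm_nonneg p 𝕜 (x - B.proj F x)
  exact hmain.trans (by gcongr; exact le_max_left _ _)

end Families

end SeqGreedy

namespace SeqGreedy

/-! ### Translates of the pattern of partial sums. -/

section GapSet

/-- The set `k + {a_1, …, a_1 + ⋯ + a_ℓ}`, written through its zero-based indices. -/
def gapSet (a : ℕ → ℕ) (k ℓ : ℕ) : Finset ℕ :=
  (Finset.range ℓ).image fun j => (k + ∑ i ∈ Finset.range (j + 1), a i) - 1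

theorem empty_mem_gapFamily (a : ℕ → ℕ) : ∅ ∈ gapFamily a := Or.inl rfl

theorem gapSet_mem_gapFamily (a : ℕ → ℕ) (k : ℕ) {ℓ : ℕ} (hℓ : 1 ≤ ℓ) :
    gapSet a k ℓ ∈ gapFamily a := Or.inr ⟨k, ℓ, hℓ, rfl⟩

variable {a : ℕ → ℕ} (ha : ∀ n, 0 < a n)

include ha

theorem strictMono_sum_range_succ : StrictMono fun j => ∑ i ∈ Finset.range (j + 1), a i :=
  strictMono_nat_of_lt_succ fun j => by
    have := ha (j + 1)
    rw [Finset.sum_range_succ _ (j + 1)]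
    omega

theorem succ_le_sum_range_succ (j : ℕ) : j + 1 ≤ ∑ i ∈ Finset.range (j + 1), a i := by
  simpa using Finset.card_nsmul_le_sum (Finset.range (j + 1)) a 1 fun i _ => ha i

theorem card_gapSet (k ℓ : ℕ) : (gapSet a k ℓ).card = ℓ := by
  rw [gapSet, Finset.card_image_of_injective, Finset.card_range]
  intro i j h
  have h1 := succ_le_sum_range_succ ha i
  have h2 := succ_le_sum_range_succ ha j
  refine (strictMono_sum_range_succ ha).injective ?_
  simp only at h ⊢
  omega

theorem le_of_mem_gapSet {k ℓ n : ℕ} (hn : n ∈ gapSet a k ℓ) : k ≤ n := by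
  obtain ⟨j, -, rfl⟩ := Finset.mem_image.1 hn
  have := succ_le_sum_range_succ ha j
  omega

/-- With gaps at most `M`, each integer from `a 0` on exceeds some partial sum by less than `M`; the
excess is the translation `k`. The bound `j ≤ d` in the induction ensures that `L` terms of the
pattern suffice. -/
theorem exists_mem_gapSet {M : ℕ} (hM : ∀ n, a n ≤ M) {n : ℕ} (hn : a 0 ≤ n + 1) {L : ℕ}
    (hL : n < L) : ∃ k < M, n ∈ gapSet a k L := by
  have key : ∀ d, ∃ k < M, ∃ j ≤ d, a 0 + d = k + ∑ i ∈ Finset.range (j + 1), a i := by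
    intro d
    induction d with
    | zero => exact ⟨0, (ha 0).trans_le (hM 0), 0, le_rfl, by simp⟩
    | succ d ih =>
      obtain ⟨k, hk, j, hj, h⟩ := ih
      rcases lt_or_ge (k + 1) M with hk' | hk'
      · exact ⟨k + 1, hk', j, by omega, by omega⟩
      -- Here `k = M - 1`. The excess would reach `M`, so the next partial sum is used and the
      -- excess drops to `M - a (j + 1)`.
      · have h1 := ha (j + 1)
        have h2 := hM (j + 1)
        refine ⟨M - a (j + 1), by omega, j + 1, by omega, ?_⟩
        rw [Finset.sum_range_succ]
        omega
  obtain ⟨k, hk, j, hj, h⟩ := key (n + 1 - a 0)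
  have h0 := ha 0
  refine ⟨k, hk, Finset.mem_image.2 ⟨j, Finset.mem_range.2 (by omega), by omega⟩⟩

end GapSet

/-! ### Bounded gaps: family-almost greedy implies almost greedy. -/

section Bounded

variable {𝕜 : Type v} {X : Type u} [RCLike 𝕜] [AddCommGroup X] [Module 𝕜 X]
  [UniformSpace X] [Norm X]

open PNormedSpace

namespace GBasis.FamilyAlmostGreedy

/-- A vector supported on a part of a member of the family is dominated by a flat vector supported
on a disjoint set of at least the same size. -/
theorem norm_proj_le_flat {B : GBasis 𝕜 X} {Δ : ℝ} {𝓕 : Set (Finset ℕ)}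
    (h : ∀ (x : X) (Λ : Finset ℕ), B.IsGreedySet x Λ → ∀ F ∈ 𝓕, F.card ≤ Λ.card →
      ‖x - B.proj Λ x‖ ≤ Δ * ‖x - B.proj F x‖)
    {A F D : Finset ℕ} (hF : F ∈ 𝓕) (hAF : A ⊆ F) (hFD : Disjoint F D)
    (hAD : A.card ≤ D.card) {α : ℝ} (hα : 0 ≤ α) (x : X) (hx : ∀ n ∈ A, ‖B.coord n x‖ ≤ α) :
    ‖B.proj A x‖ ≤ Δ * ‖∑ n ∈ D, (α : 𝕜) • B.vec n‖ := by
  -- The test vector is `P_A x + α 1_{F \ A} + α 1_D`. Removing the greedy set `(F \ A) ∪ D` leaves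
  -- `P_A x`; removing `F` leaves `α 1_D`.
  set b : ℕ → 𝕜 := fun n => if n ∈ A then B.coord n x else α with hb
  set z : X := ∑ n ∈ F ∪ D, b n • B.vec n with hz
  have hDA : Disjoint D A := (Finset.disjoint_of_subset_left hAF hFD).symm
  have hbA : ∑ n ∈ A, b n • B.vec n = B.proj A x :=
    Finset.sum_congr rfl fun n hn => by simp [hb, hn]
  have hbD : ∑ n ∈ D, b n • B.vec n = ∑ n ∈ D, (α : 𝕜) • B.vec n :=
    Finset.sum_congr rfl fun n hn => by simp [hb, Finset.disjoint_left.1 hDA hn]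
  have hsplit : F ∪ D = A ∪ (F \ A ∪ D) := by
    rw [← Finset.union_assoc, Finset.union_sdiff_of_subset hAF]
  have hdA : Disjoint A (F \ A ∪ D) :=
    Finset.disjoint_union_right.2 ⟨Finset.disjoint_sdiff, hDA.symm⟩
  have hdF : Disjoint (F \ A) D := Finset.disjoint_of_subset_left Finset.sdiff_subset hFD
  have hgreedy : B.IsGreedySet z (F \ A ∪ D) := by
    intro n hn k hk
    have hnA : n ∉ A := fun hnA => Finset.disjoint_left.1 hdA hnA hn
    have hnz : ‖B.coord n z‖ = α := by
      rw [hz, B.coord_sum_smul, if_pos (by rw [hsplit]; exact Finset.mem_union_right _ hn)]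
      simp [hb, hnA, abs_of_nonneg hα]
    rw [hnz, hz, B.coord_sum_smul]
    split_ifs with hkU
    · rw [hsplit] at hkU
      have hkA := (Finset.mem_union.1 hkU).resolve_right hk
      simpa [hb, hkA] using hx k hkA
    · simpa using hα
  have hcard : F.card ≤ (F \ A ∪ D).card := by
    rw [Finset.card_union_of_disjoint hdF, Finset.card_sdiff_of_subset hAF]
    omega
  have := h z _ hgreedy F hF hcard
  have hz₁ : z = ∑ n ∈ F, b n • B.vec n + ∑ n ∈ D, (α : 𝕜) • B.vec n := by
    rw [hz, Finset.sum_union hFD, hbD]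
  have hz₂ : z = B.proj A x + ∑ n ∈ F \ A ∪ D, b n • B.vec n := by
    rw [hz, hsplit, Finset.sum_union hdA, hbA]
  have hp₁ : B.proj F z = ∑ n ∈ F, b n • B.vec n := by
    rw [hz, B.proj_sum_smul, Finset.inter_eq_left.2 Finset.subset_union_left]
  have hp₂ : B.proj (F \ A ∪ D) z = ∑ n ∈ F \ A ∪ D, b n • B.vec n := by
    rw [hz, B.proj_sum_smul, Finset.inter_eq_left.2 (hsplit ▸ Finset.subset_union_right)]
  have e₁ : z - B.proj F z = ∑ n ∈ D, (α : 𝕜) • B.vec n := by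
    rw [hp₁, hz₁, add_sub_cancel_left]
  have e₂ : z - B.proj (F \ A ∪ D) z = B.proj A x := by
    rw [hp₂, hz₂, add_sub_cancel_right]
  rwa [e₁, e₂] at this

variable (p : ℝ) [PNormedSpace p 𝕜 X]

include p

/-- Replace the coefficients of `y` on `D` by `α`. The set `Λ` stays greedy for the new vector `z`,
and `z - P_D z = y - P_D y`, so deleting `Λ` from `z` costs little. Deleting `Λ` from `y` also costs
little, and the two remainders differ by `α 1_D - P_D y`. -/
theorem flat_rpow_le (hp : 0 < p) {B : GBasis 𝕜 X} {Δ : ℝ} (hΔ : 1 ≤ Δ) {𝓕 : Set (Finset ℕ)}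
    (h𝓕 : ∅ ∈ 𝓕)
    (h : ∀ (x : X) (Λ : Finset ℕ), B.IsGreedySet x Λ → ∀ F ∈ 𝓕, F.card ≤ Λ.card →
      ‖x - B.proj Λ x‖ ≤ Δ * ‖x - B.proj F x‖)
    {y : X} {Λ D : Finset ℕ} (hΛ : B.IsGreedySet y Λ) (hD : D ∈ 𝓕) (hDc : D.card ≤ Λ.card)
    (hdisj : Disjoint Λ D) (hDy : ‖B.proj D y‖ ≤ ‖y‖) {α : ℝ} (hα : 0 ≤ α)
    (hαΛ : ∀ n ∈ Λ, α ≤ ‖B.coord n y‖) :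
    ‖∑ n ∈ D, (α : 𝕜) • B.vec n‖ ^ p ≤ 4 * Δ ^ p * ‖y‖ ^ p := by
  have hy := norm_nonneg p 𝕜 y
  have hΔ0 : 0 ≤ Δ := zero_le_one.trans hΔ
  set u : X := ∑ n ∈ D, (α : 𝕜) • B.vec n with hu
  have hcu : ∀ m, B.coord m u = if m ∈ D then (α : 𝕜) else 0 :=
    B.coord_sum_smul D fun _ => (α : 𝕜)
  set z : X := y - B.proj D y + u with hz
  have hcz : ∀ m, B.coord m z = if m ∈ D then (α : 𝕜) else B.coord m y := by
    intro m
    rw [hz, map_add, map_sub, hcu, B.coord_proj]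
    split_ifs <;> simp
  have hnD : ∀ n ∈ Λ, n ∉ D := fun n hn => Finset.disjoint_left.1 hdisj hn
  have hgreedy : B.IsGreedySet z Λ := by
    intro n hn k hk
    rw [hcz, hcz, if_neg (hnD n hn)]
    split_ifs with hkD
    · simpa [abs_of_nonneg hα] using hαΛ n hn
    · exact hΛ n hn k hk
  have hDz : B.proj D z = u :=
    Finset.sum_congr rfl fun n hn => by rw [hcz, if_pos hn]
  have hΛz : B.proj Λ z = B.proj Λ y := B.proj_congr fun n hn => by rw [hcz, if_neg (hnD n hn)]
  have h1 := h z Λ hgreedy D hD hDc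
  have h2 := h y Λ hΛ ∅ h𝓕 (by simp)
  rw [hDz, hΛz, hz, add_sub_cancel_right, ← hz] at h1
  rw [B.proj_empty, sub_zero] at h2
  have hΔp : 1 ≤ Δ ^ p := Real.one_le_rpow hΔ hp.le
  have hyp := Real.rpow_nonneg hy p
  have hDyp : ‖B.proj D y‖ ^ p ≤ ‖y‖ ^ p :=
    Real.rpow_le_rpow (norm_nonneg p 𝕜 _) hDy hp.le
  have h1p : ‖z - B.proj Λ y‖ ^ p ≤ Δ ^ p * (‖y‖ ^ p + ‖y‖ ^ p) := by
    refine (Real.rpow_le_rpow (norm_nonneg p 𝕜 _) h1 hp.le).trans ?_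
    rw [Real.mul_rpow hΔ0 (norm_nonneg p 𝕜 _)]
    gcongr
    exact (norm_sub_rpow_le p 𝕜 _ _).trans (by gcongr)
  have h2p : ‖y - B.proj Λ y‖ ^ p ≤ Δ ^ p * ‖y‖ ^ p := by
    refine (Real.rpow_le_rpow (norm_nonneg p 𝕜 _) h2 hp.le).trans ?_
    rw [Real.mul_rpow hΔ0 hy]
  -- The three terms contribute `2 Δ^p`, `Δ^p` and `1`, at most `4 Δ^p` in all.
  have hu' : u = (z - B.proj Λ y) - (y - B.proj Λ y) + B.proj D y := by
    rw [hz]; abel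
  rw [hu']
  refine (norm_add_rpow_le 𝕜 _ _).trans ?_
  have h3 := norm_sub_rpow_le p 𝕜 (z - B.proj Λ y) (y - B.proj Λ y)
  nlinarith

theorem almostGreedy_of_bddAbove (hp : 0 < p) {a : ℕ → ℕ} (ha : ∀ n, 0 < a n)
    (hbdd : BddAbove (Set.range a)) {B : GBasis 𝕜 X}
    (hB : B.FamilyAlmostGreedy (gapFamily a)) : B.AlmostGreedy := by
  obtain ⟨M, hM⟩ := hbdd
  replace hM : ∀ n, a n ≤ M := fun n => hM ⟨n, rfl⟩
  obtain ⟨Δ, hΔ, hB⟩ := hB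
  have h𝓕 := empty_mem_gapFamily a
  have hΔ0 : 0 ≤ Δ := zero_le_one.trans hΔ
  have h : ∀ (x : X) (Λ : Finset ℕ), B.IsGreedySet x Λ → ∀ F ∈ gapFamily a, F.card ≤ Λ.card →
      ‖x - B.proj Λ x‖ ≤ Δ * ‖x - B.proj F x‖ := fun x Λ hΛ F hF hFc =>
    (hB x Λ.card (minCard_eq_zero h𝓕 ▸ Nat.zero_le _) Λ rfl hΛ).trans
      (mul_le_mul_of_nonneg_left (familyError_le p 𝕜 B x hF hFc) hΔ0)
  obtain ⟨K, hK, hvec, hcoord⟩ := exists_coord_le_mul p 𝕜 B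
  -- Contributions of `y - P_{Λ \ A} y`, of the `M` translates, and of the at most `M` indices below
  -- the reach of every translate, which are estimated one by one.
  set Q : ℝ := Δ ^ p + (M * (Δ ^ p * (4 * Δ ^ p)) + M * (K * K) ^ p) with hQ
  have hQ0 : 0 < Q := by positivity
  refine .of_forall_le (C := Q ^ p⁻¹) (by positivity) fun x Λ hΛ A hA => ?_
  refine le_mul_of_rpow_le p 𝕜 hp hQ0.le ?_
  set y := x - B.proj A x with hy
  have hy0 := norm_nonneg p 𝕜 y
  have hΛy : B.IsGreedySet y (Λ \ A) := hΛ.sdiff A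
  have hrcard : (A \ Λ).card = (Λ \ A).card := Finset.card_sdiff_comm hA
  have hfirst : ‖y - B.proj (Λ \ A) y‖ ^ p ≤ Δ ^ p * ‖y‖ ^ p := by
    have := h y _ hΛy ∅ h𝓕 (by simp)
    rw [B.proj_empty, sub_zero] at this
    rw [← Real.mul_rpow hΔ0 hy0]
    exact Real.rpow_le_rpow (norm_nonneg p 𝕜 _) this hp.le
  have hsecond : ‖B.proj (A \ Λ) x‖ ^ p ≤
      (M * (Δ ^ p * (4 * Δ ^ p)) + M * (K * K) ^ p) * ‖y‖ ^ p := by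
    rcases Finset.eq_empty_or_nonempty (Λ \ A) with he | hne
    · rw [he, Finset.card_empty, Finset.card_eq_zero] at hrcard
      rw [hrcard, B.proj_empty, norm_zero' p 𝕜, Real.zero_rpow hp.ne']
      positivity
    obtain ⟨n₀, hn₀, hmin⟩ := Finset.exists_min_image (Λ \ A) (fun n => ‖B.coord n y‖) hne
    set α := ‖B.coord n₀ y‖ with hα
    have hα0 : 0 ≤ α := _root_.norm_nonneg _
    have hαx : ∀ n ∈ A \ Λ, ‖B.coord n x‖ ≤ α := by
      intro n hn
      have : B.coord n₀ y = B.coord n₀ x := by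
        simp [hy, B.coord_proj, (Finset.mem_sdiff.1 hn₀).2]
      rw [hα, this]
      exact hΛ n₀ (Finset.mem_sdiff.1 hn₀).1 n (Finset.mem_sdiff.1 hn).2
    set L := A.sup id + 1 with hL
    have hAL : ∀ n ∈ A, n < L := fun n hn => Nat.lt_succ_of_le (Finset.le_sup (f := id) hn)
    obtain ⟨N, hN⟩ := exists_forall_proj_le p 𝕜 hp B y (Λ \ A).card
    set S := (Λ \ A) ∪ (Finset.range M).biUnion fun k => gapSet a k L with hS
    -- Beyond `N`, the projection of `y` onto `D` is no larger than `y`; beyond `S`, the set `D`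
    -- avoids `Λ \ A` and all the covering translates.
    set D := gapSet a (max N (S.sup id + 1)) (Λ \ A).card with hDdef
    have hDge : ∀ n ∈ D, max N (S.sup id + 1) ≤ n := fun n hn => le_of_mem_gapSet ha hn
    have hDc : D.card = (Λ \ A).card := card_gapSet ha _ _
    have hD : D ∈ gapFamily a := gapSet_mem_gapFamily a _ (Finset.card_pos.2 hne)
    have hSD : Disjoint S D := by
      refine Finset.disjoint_left.2 fun n hnS hnD => ?_
      have h1 : n ≤ S.sup id := Finset.le_sup (f := id) hnS
      have h2 := (le_max_right _ _).trans (hDge n hnD)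
      omega
    have hflat := flat_rpow_le p hp hΔ h𝓕 h hΛy hD hDc.le
      (Finset.disjoint_of_subset_left Finset.subset_union_left hSD)
      (hN D hDc.le fun n hn => (le_max_left _ _).trans (hDge n hn)) hα0 hmin
    set A₁ := (A \ Λ).filter fun n => a 0 ≤ n + 1 with hA₁
    set A₂ := (A \ Λ).filter fun n => ¬ a 0 ≤ n + 1 with hA₂
    have hsplit : B.proj (A \ Λ) x = B.proj A₁ x + B.proj A₂ x :=
      (Finset.sum_filter_add_sum_filter_not _ _ _).symm
    have hcov : ∀ n ∈ A₁, ∃ k < M, n ∈ gapSet a k L := fun n hn => by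
      obtain ⟨hn1, hn2⟩ := Finset.mem_filter.1 hn
      exact exists_mem_gapSet ha hM hn2 (hAL n (Finset.mem_sdiff.1 hn1).1)
    choose! κ hκM hκ using hcov
    have hA₁le : ‖B.proj A₁ x‖ ^ p ≤ M * (Δ ^ p * (4 * Δ ^ p)) * ‖y‖ ^ p := by
      have hfib : B.proj A₁ x =
          ∑ k ∈ Finset.range M, B.proj (A₁.filter fun n => κ n = k) x :=
        (Finset.sum_fiberwise_of_maps_to (fun n hn => Finset.mem_range.2 (hκM n hn)) _).symm
      rw [hfib]
      refine (norm_sum_rpow_le p 𝕜 hp _ _).trans ?_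
      have hterm : ∀ k ∈ Finset.range M, ‖B.proj (A₁.filter fun n => κ n = k) x‖ ^ p ≤
          Δ ^ p * (4 * Δ ^ p) * ‖y‖ ^ p := by
        intro k hk
        have hsub : (A₁.filter fun n => κ n = k) ⊆ A \ Λ :=
          (Finset.filter_subset _ _).trans (Finset.filter_subset _ _)
        have := norm_proj_le_flat (A := A₁.filter fun n => κ n = k) h
          (gapSet_mem_gapFamily a k (ℓ := L) (by omega))
          (fun n hn => by
            obtain ⟨hn1, rfl⟩ := Finset.mem_filter.1 hn
            exact hκ n hn1)
          (Finset.disjoint_of_subset_left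
            ((Finset.subset_biUnion_of_mem (fun k => gapSet a k L) hk).trans
              Finset.subset_union_right) hSD)
          ((Finset.card_le_card hsub).trans (hrcard.trans hDc.symm).le) hα0 x
          fun n hn => hαx n (hsub hn)
        refine (Real.rpow_le_rpow (norm_nonneg p 𝕜 _) this hp.le).trans ?_
        rw [Real.mul_rpow hΔ0 (norm_nonneg p 𝕜 _), mul_assoc]
        gcongr
      refine (Finset.sum_le_card_nsmul _ _ _ hterm).trans ?_
      rw [Finset.card_range, nsmul_eq_mul, ← mul_assoc]
    have hA₂le : ‖B.proj A₂ x‖ ^ p ≤ M * (K * K) ^ p * ‖y‖ ^ p := by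
      refine (norm_sum_rpow_le p 𝕜 hp _ _).trans ?_
      have hterm : ∀ n ∈ A₂, ‖B.coord n x • B.vec n‖ ^ p ≤ (K * K) ^ p * ‖y‖ ^ p := by
        intro n hn
        have hv := norm_nonneg p 𝕜 (B.vec n)
        rw [← Real.mul_rpow (by positivity) hy0, PNormedSpace.norm_smul p]
        refine Real.rpow_le_rpow (by positivity) ?_ hp.le
        calc ‖B.coord n x‖ * ‖B.vec n‖ ≤ (K * ‖y‖) * K := by
              gcongr
              · exact (hαx n (Finset.filter_subset _ _ hn)).trans (hcoord n₀ y)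
              · exact hvec n
          _ = K * K * ‖y‖ := by ring
      have hcard : A₂.card ≤ M := by
        have hsub : A₂ ⊆ Finset.range M := fun n hn => by
          have h1 := (Finset.mem_filter.1 hn).2
          have h2 := hM 0
          exact Finset.mem_range.2 (by omega)
        simpa using Finset.card_le_card hsub
      refine (Finset.sum_le_card_nsmul _ _ _ hterm).trans ?_
      rw [nsmul_eq_mul, ← mul_assoc]
      gcongr
    rw [hsplit, add_mul]
    exact (norm_add_rpow_le 𝕜 _ _).trans (add_le_add hA₁le hA₂le)
  rw [B.sub_proj_eq A Λ x, ← hy, hQ, add_mul]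
  exact (norm_add_rpow_le 𝕜 _ _).trans (add_le_add hfirst hsecond)

end GBasis.FamilyAlmostGreedy

end Bounded

/-! ### Unbounded gaps: a set nearly avoided by the family. -/

section Unbounded

/-- If the gaps are unbounded, some infinite set meets each member of the family in at most one
point. -/
theorem exists_infinite_subsingleton_inter {a : ℕ → ℕ} (ha : ∀ n, 0 < a n)
    (hbdd : ¬ BddAbove (Set.range a)) :
    ∃ S : Set ℕ, S.Infinite ∧ ∀ F ∈ gapFamily a, ((F : Set ℕ) ∩ S).Subsingleton := by
  have hbig : ∀ n, ∃ i, n < a (i + 1) := by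
    intro n
    by_contra! hcon
    refine hbdd ⟨max n (a 0), ?_⟩
    rintro _ ⟨i, rfl⟩
    cases i with
    | zero => exact le_max_right _ _
    | succ i => exact (hcon i).trans (le_max_left _ _)
  have hstep : ∀ n, ∃ n', n < n' ∧
      ∀ k ≤ n, ∀ j, n' + 1 ≠ k + ∑ i ∈ Finset.range (j + 1), a i := by
    intro n
    obtain ⟨i, hi⟩ := hbig (n + 1)
    have hpos := succ_le_sum_range_succ ha i
    have hsum := Finset.sum_range_succ a (i + 1)
    -- In one-based terms this is the last integer of a gap longer than `n + 1`. A shift by `k ≤ n`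
    -- moves the left end of the gap too little to reach it, and pushes the right end further away.
    refine ⟨∑ l ∈ Finset.range (i + 1 + 1), a l - 2, by omega, fun k hk j hj => ?_⟩
    rcases le_or_gt j i with hji | hji
    · have := (strictMono_sum_range_succ ha).monotone hji
      omega
    · have := (strictMono_sum_range_succ ha).monotone (show i + 1 ≤ j from hji)
      omega
  choose f hf hfk using hstep
  set ν : ℕ → ℕ := fun t => f^[t] 0 with hν
  have hsucc : ∀ t, ν (t + 1) = f (ν t) := fun t => Function.iterate_succ_apply' f t 0
  have hmono : StrictMono ν := strictMono_nat_of_lt_succ fun t => hsucc t ▸ hf (ν t)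
  refine ⟨Set.range ν, Set.infinite_range_of_injective hmono.injective, ?_⟩
  rintro F (rfl | ⟨k, ℓ, -, rfl⟩)
  · simp
  have key : ∀ s t, s < t → ν s ∈ gapSet a k ℓ → ν t ∈ gapSet a k ℓ → False := by
    intro s t hst hs ht
    obtain ⟨t, rfl⟩ := Nat.exists_eq_add_of_lt hst
    -- Containing an earlier point forces `k` to be at most that point, and the later points were
    -- chosen to avoid all such translates.
    have hks : k ≤ ν (s + t) := (le_of_mem_gapSet ha hs).trans (hmono.monotone (by omega))
    obtain ⟨j, -, hj⟩ := Finset.mem_image.1 ht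
    have := succ_le_sum_range_succ ha j
    rw [hsucc] at hj
    exact hfk _ k hks j (by omega)
  rintro _ ⟨hs, s, rfl⟩ _ ⟨ht, t, rfl⟩
  rcases lt_trichotomy s t with hst | rfl | hst
  · exact (key s t hst hs ht).elim
  · rfl
  · exact (key t s hst ht hs).elim

end Unbounded

end SeqGreedy

namespace SeqGreedy

theorem PNormedSpace.of_normedSpace {p : ℝ} (hp : 0 < p) (hp1 : p ≤ 1) (𝕜 : Type v) (X : Type u)
    [RCLike 𝕜] [NormedAddCommGroup X] [NormedSpace 𝕜 X] : PNormedSpace p 𝕜 X where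
  norm_nonneg := _root_.norm_nonneg
  norm_eq_zero_iff _ := _root_.norm_eq_zero
  norm_smul := _root_.norm_smul
  norm_add_rpow_le x y :=
    (Real.rpow_le_rpow (_root_.norm_nonneg _) (norm_add_le x y) hp.le).trans
      (Real.rpow_add_le_add_rpow (_root_.norm_nonneg _) (_root_.norm_nonneg _) hp.le hp1)
  uniformity_hasBasis := by
    simpa only [dist_eq_norm] using Metric.uniformity_basis_dist (α := X)

/-! ### Weights `1/√j` along `S` and their alternating sums. -/

section Weight

open Classical in
/-- The weight `1 / √(j + 1)` at the `j`-th element of `S` (counted from `0`), and `0` off `S`. -/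
noncomputable def weight (S : Set ℕ) (n : ℕ) : ℝ :=
  if n ∈ S then (√(Nat.count (· ∈ S) n + 1 : ℝ))⁻¹ else 0

variable {S : Set ℕ}

theorem weight_of_notMem {n : ℕ} (hn : n ∉ S) : weight S n = 0 := if_neg hn

theorem weight_nonneg (S : Set ℕ) (n : ℕ) : 0 ≤ weight S n := by
  unfold weight; positivity

theorem weight_le_one (S : Set ℕ) (n : ℕ) : weight S n ≤ 1 := by
  unfold weight
  split_ifs
  · exact inv_le_one_of_one_le₀ (Real.one_le_sqrt.2 (le_add_of_nonneg_left (Nat.cast_nonneg _)))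
  · exact zero_le_one

open Classical in
theorem weight_sq_of_mem {n : ℕ} (hn : n ∈ S) :
    weight S n ^ 2 = ((Nat.count (· ∈ S) n : ℝ) + 1)⁻¹ := by
  rw [weight, if_pos hn, inv_pow, Real.sq_sqrt (by positivity)]

-- Telescoping of `1/√(c + 1) ≤ 2 (√(c + 1) - √c)`.
open Classical in
theorem sum_weight_le (S : Set ℕ) (N : ℕ) :
    ∑ n ∈ Finset.range N, weight S n ≤ 2 * √(Nat.count (· ∈ S) N) := by
  induction N with
  | zero => simp
  | succ N ih =>
    rw [Finset.sum_range_succ, Nat.count_succ]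
    by_cases hN : N ∈ S
    · rw [weight, if_pos hN, if_pos hN]
      push_cast
      set c : ℝ := ((Nat.count (· ∈ S) N : ℕ) : ℝ) with hc
      have hc0 : 0 ≤ c := Nat.cast_nonneg _
      have h1 := Real.sq_sqrt hc0
      have h2 := Real.sq_sqrt (by positivity : 0 ≤ c + 1)
      have h3 : 0 < √(c + 1) := by positivity
      have h4 : (√(c + 1))⁻¹ ≤ 2 * (√(c + 1) - √c) := by
        rw [inv_le_iff_one_le_mul₀ h3]
        nlinarith [sq_nonneg (√(c + 1) - √c)]
      linarith
    · rw [weight_of_notMem hN, if_neg hN]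
      simpa using ih

open Classical in
theorem sum_weight_sq (S : Set ℕ) (N : ℕ) :
    ∑ n ∈ Finset.range N, weight S n ^ 2 =
      ∑ i ∈ Finset.range (Nat.count (· ∈ S) N), (1 : ℝ) / (i + 1) := by
  induction N with
  | zero => simp
  | succ N ih =>
    rw [Finset.sum_range_succ, Nat.count_succ, ih]
    by_cases hN : N ∈ S
    · rw [if_pos hN, Finset.sum_range_succ, weight_sq_of_mem hN, one_div]
    · rw [if_neg hN, weight_of_notMem hN]
      simp

theorem exists_lt_sum_weight_sq (hS : S.Infinite) (C : ℝ) :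
    ∃ N, C < ∑ n ∈ Finset.range N, weight S n ^ 2 := by
  classical
  obtain ⟨m, hm⟩ := (Real.tendsto_sum_range_one_div_nat_succ_atTop.eventually_gt_atTop C).exists
  refine ⟨Nat.nth (· ∈ S) m, ?_⟩
  rwa [sum_weight_sq, Nat.count_nth_of_infinite (p := (· ∈ S)) hS]

open Classical in
/-- The alternating sign along the elements of `S`. -/
noncomputable def altSign (S : Set ℕ) (n : ℕ) : ℝ := (-1) ^ Nat.count (· ∈ S) n

theorem altSign_eq_or (S : Set ℕ) (n : ℕ) : altSign S n = 1 ∨ altSign S n = -1 :=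
  neg_one_pow_eq_or ℝ _

theorem sum_altSign_mem_Icc (S : Set ℕ) (N : ℕ) :
    ∑ n ∈ Finset.range N, altSign S n * weight S n ^ 2 ∈ Set.Icc (0 : ℝ) 1 := by
  classical
  -- These are partial sums of the alternating harmonic series; the bounds by parity leave room for
  -- the next term.
  have key : (Even (Nat.count (· ∈ S) N) →
        0 ≤ ∑ n ∈ Finset.range N, altSign S n * weight S n ^ 2 ∧
        ∑ n ∈ Finset.range N, altSign S n * weight S n ^ 2 ≤
          1 - ((Nat.count (· ∈ S) N : ℝ) + 1)⁻¹) ∧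
      (¬ Even (Nat.count (· ∈ S) N) →
        ((Nat.count (· ∈ S) N : ℝ) + 1)⁻¹ ≤ ∑ n ∈ Finset.range N, altSign S n * weight S n ^ 2 ∧
        ∑ n ∈ Finset.range N, altSign S n * weight S n ^ 2 ≤ 1) := by
    induction N with
    | zero => simp
    | succ N ih =>
      rw [Finset.sum_range_succ, Nat.count_succ]
      by_cases hN : N ∈ S
      · rw [if_pos hN, weight_sq_of_mem hN, altSign, Nat.even_add_one, not_not]
        push_cast
        set c := Nat.count (· ∈ S) N
        have hc : ((c : ℝ) + 1 + 1)⁻¹ ≤ ((c : ℝ) + 1)⁻¹ := by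
          gcongr
          linarith
        have hc0 : 0 ≤ ((c : ℝ) + 1)⁻¹ := by positivity
        constructor
        · intro hodd
          have := ih.2 hodd
          rw [(Nat.not_even_iff_odd.1 hodd).neg_one_pow]
          constructor <;> linarith
        · intro heven
          have := ih.1 heven
          rw [heven.neg_one_pow]
          constructor <;> linarith
      · rw [if_neg hN, weight_of_notMem hN]
        simpa using ih
  have hpos : 0 ≤ ((Nat.count (· ∈ S) N : ℝ) + 1)⁻¹ := by positivity
  by_cases he : Even (Nat.count (· ∈ S) N)
  · have := key.1 he
    constructor <;> linarith
  · have := key.2 he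
    constructor <;> linarith

theorem half_sum_weight_sq_le (S : Set ℕ) (N : ℕ) :
    (∑ n ∈ Finset.range N, weight S n ^ 2) / 2 ≤
      ∑ n ∈ Finset.range N, if altSign S n = 1 then weight S n ^ 2 else 0 := by
  have h := (sum_altSign_mem_Icc S N).1
  have : ∑ n ∈ Finset.range N, (if altSign S n = 1 then weight S n ^ 2 else 0) =
      (∑ n ∈ Finset.range N, weight S n ^ 2 +
        ∑ n ∈ Finset.range N, altSign S n * weight S n ^ 2) / 2 := by
    rw [← Finset.sum_add_distrib, Finset.sum_div]
    refine Finset.sum_congr rfl fun n _ => ?_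
    rcases altSign_eq_or S n with h | h <;> rw [h] <;> norm_num
  linarith

end Weight

/-! ### Properties of a basis with the weighted norm. -/

section WeightedNorm

variable {𝕜 : Type v} {X : Type u} [RCLike 𝕜] [NormedAddCommGroup X] [NormedSpace 𝕜 X]

/-- The norm is the maximum of the supremum of the coefficients, of the `ℓ₂`-norm of the
coefficients indexed by `S`, and of the supremum of the weighted partial sums of the coefficients
(with weights supported on `S`). -/
structure GBasis.IsWeightedNorm (B : GBasis 𝕜 X) (S : Set ℕ) : Prop where
  norm_coord_le : ∀ (z : X) (n : ℕ), ‖B.coord n z‖ ≤ ‖z‖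
  sum_sq_le : ∀ (z : X) (s : Finset ℕ), (∀ n ∈ s, n ∈ S) → ∑ n ∈ s, ‖B.coord n z‖ ^ 2 ≤ ‖z‖ ^ 2
  norm_sum_weight_le : ∀ (z : X) (N : ℕ),
    ‖∑ n ∈ Finset.range N, (weight S n : 𝕜) * B.coord n z‖ ≤ ‖z‖
  norm_le : ∀ (z : X) (R : ℝ), 0 ≤ R → (∀ n, ‖B.coord n z‖ ≤ R) →
    (∀ s : Finset ℕ, (∀ n ∈ s, n ∈ S) → ∑ n ∈ s, ‖B.coord n z‖ ^ 2 ≤ R ^ 2) →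
    (∀ N : ℕ, ‖∑ n ∈ Finset.range N, (weight S n : 𝕜) * B.coord n z‖ ≤ R) → ‖z‖ ≤ R

theorem norm_sum_le_of_subsingleton {E : Type*} [SeminormedAddCommGroup E] {f : ℕ → E} {R : ℝ}
    (hR : 0 ≤ R) {T : Set ℕ} (hT : T.Subsingleton) (hf : ∀ n, f n ≠ 0 → n ∈ T)
    (hfR : ∀ n, ‖f n‖ ≤ R) (s : Finset ℕ) : ‖∑ n ∈ s, f n‖ ≤ R := by
  by_cases h : ∃ n ∈ s, f n ≠ 0
  · obtain ⟨n, hn, hfn⟩ := h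
    rw [Finset.sum_eq_single_of_mem n hn]
    · exact hfR n
    · intro m _ hmn
      by_contra hm
      exact hmn (hT (hf m hm) (hf n hfn))
  · push Not at h
    rw [Finset.sum_eq_zero h, norm_zero]
    exact hR

theorem exists_norm_sum_le_of_summable {ι E : Type*} [NormedAddCommGroup E] {f : ι → E}
    (hf : Summable f) : ∃ C, ∀ s : Finset ι, ‖∑ i ∈ s, f i‖ ≤ C := by
  classical
  obtain ⟨s₀, hs₀⟩ := hf.vanishing (Metric.ball_mem_nhds (0 : E) one_pos)
  refine ⟨1 + ∑ i ∈ s₀, ‖f i‖, fun s => ?_⟩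
  rw [← Finset.sum_inter_add_sum_sdiff s s₀, add_comm]
  have h1 : ‖∑ i ∈ s \ s₀, f i‖ < 1 := by
    simpa using hs₀ (s \ s₀) Finset.sdiff_disjoint
  have h2 : ‖∑ i ∈ s ∩ s₀, f i‖ ≤ ∑ i ∈ s₀, ‖f i‖ :=
    (norm_sum_le _ _).trans
      (Finset.sum_le_sum_of_subset_of_nonneg Finset.inter_subset_right fun _ _ _ => norm_nonneg _)
  exact (norm_add_le _ _).trans (add_le_add h1.le h2)

namespace GBasis.IsWeightedNorm

variable {B : GBasis 𝕜 X} {S : Set ℕ}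

/-- Projections do not increase the sup and `ℓ₂` parts, so only the weighted partial sums need
control. -/
theorem norm_proj_le (hB : B.IsWeightedNorm S) {A : Finset ℕ} {z : X} {R : ℝ} (hR : ‖z‖ ≤ R)
    (h : ∀ N : ℕ, ‖∑ n ∈ Finset.range N, if n ∈ A then (weight S n : 𝕜) * B.coord n z else 0‖ ≤ R) :
    ‖B.proj A z‖ ≤ R := by
  have hle : ∀ n, ‖B.coord n (B.proj A z)‖ ≤ ‖B.coord n z‖ := fun n => by
    rw [B.coord_proj]; split_ifs <;> simp
  refine hB.norm_le _ R ((norm_nonneg z).trans hR)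
    (fun n => (hle n).trans ((hB.norm_coord_le z n).trans hR)) (fun s hs => ?_) fun N => ?_
  · calc ∑ n ∈ s, ‖B.coord n (B.proj A z)‖ ^ 2 ≤ ∑ n ∈ s, ‖B.coord n z‖ ^ 2 := by
          gcongr with n; exact hle n
      _ ≤ ‖z‖ ^ 2 := hB.sum_sq_le z s hs
      _ ≤ R ^ 2 := by gcongr
  · simpa only [B.coord_proj, mul_ite, mul_zero] using h N

/-- The `ℓ₂` part and the weighted sums involve only indices in `S`, hence at most one term here,
and weights are at most `1`. -/
theorem norm_proj_le_of_subsingleton (hB : B.IsWeightedNorm S) {A : Finset ℕ}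
    (hA : ((A : Set ℕ) ∩ S).Subsingleton) {z : X} {R : ℝ} (hR : 0 ≤ R)
    (h : ∀ n ∈ A, ‖B.coord n z‖ ≤ R) : ‖B.proj A z‖ ≤ R := by
  classical
  have hle : ∀ n, ‖B.coord n (B.proj A z)‖ ≤ R := fun n => by
    rw [B.coord_proj]
    split_ifs with hn
    · exact h n hn
    · simpa using hR
  have hA' : ∀ n, B.coord n (B.proj A z) ≠ 0 → n ∈ A := fun n hn => by
    by_contra hnA
    exact hn (by rw [B.coord_proj, if_neg hnA])
  refine hB.norm_le _ R hR hle (fun s hs => ?_) fun N => ?_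
  · have := norm_sum_le_of_subsingleton (f := fun n =>
      if n ∈ S then ‖B.coord n (B.proj A z)‖ ^ 2 else 0) (sq_nonneg R) hA (fun n hn => ?_)
      (fun n => ?_) s
    · rw [Finset.sum_congr rfl fun n hn => if_pos (hs n hn)] at this
      exact (Real.le_norm_self _).trans this
    · have hnS : n ∈ S := by by_contra hnS; exact hn (if_neg hnS)
      refine ⟨hA' n fun h0 => hn ?_, hnS⟩
      simp [h0]
    · split_ifs
      · rw [Real.norm_of_nonneg (by positivity)]
        gcongr
        exact hle n
      · simpa using sq_nonneg R
  · refine norm_sum_le_of_subsingleton hR hA (fun n hn => ⟨?_, ?_⟩) (fun n => ?_) _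
    · exact hA' n fun h0 => hn (by rw [h0, mul_zero])
    · by_contra hnS
      exact hn (by rw [weight_of_notMem hnS]; simp)
    · rw [norm_mul, RCLike.norm_ofReal, abs_of_nonneg (weight_nonneg S n)]
      calc weight S n * ‖B.coord n (B.proj A z)‖ ≤ 1 * R := by
            gcongr
            · exact weight_le_one S n
            · exact hle n
        _ = R := one_mul R

theorem norm_proj_range_le (hB : B.IsWeightedNorm S) (z : X) (m : ℕ) :
    ‖B.proj (Finset.range m) z‖ ≤ ‖z‖ := by
  refine hB.norm_proj_le le_rfl fun N => ?_
  have : ∑ n ∈ Finset.range N, (if n ∈ Finset.range m then (weight S n : 𝕜) * B.coord n z else 0) =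
      ∑ n ∈ Finset.range (min N m), (weight S n : 𝕜) * B.coord n z := by
    rw [Finset.sum_ite_mem]
    congr 1
    ext n
    simp
  rw [this]
  exact hB.norm_sum_weight_le z _

/-- The weighted sums over `Λ` are handled in two ranges. While `α √count ≤ ‖z‖`, the omitted
coefficients, at most `α`, have weighted sum at most `2 ‖z‖`, so subtract them from the full partial
sum. Afterwards each weight is at most `|coefficient| / ‖z‖` on `Λ`, and the `ℓ₂` part absorbs the
rest. -/
theorem norm_proj_le_four_mul (hB : B.IsWeightedNorm S) {z : X} {Λ : Finset ℕ}
    (hΛ : B.IsGreedySet z Λ) : ‖B.proj Λ z‖ ≤ 4 * ‖z‖ := by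
  classical
  rcases Finset.eq_empty_or_nonempty Λ with rfl | hne
  · simp
  rcases eq_or_ne z 0 with rfl | hz
  · simp
  have hz0 : 0 < ‖z‖ := norm_pos_iff.2 hz
  set R := ‖z‖ with hR
  obtain ⟨n₀, hn₀, hmin⟩ := Finset.exists_min_image Λ (fun n => ‖B.coord n z‖) hne
  set α := ‖B.coord n₀ z‖ with hα
  refine hB.norm_proj_le (by linarith) fun N => ?_
  set f : ℕ → 𝕜 := fun n => if n ∈ Λ then (weight S n : 𝕜) * B.coord n z else 0 with hf
  set g : ℕ → ℝ := fun n => if n ∈ Λ ∧ n ∈ S then ‖B.coord n z‖ ^ 2 else 0 with hg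
  have hg0 : ∀ n, 0 ≤ g n := fun n => by simp only [hg]; positivity
  have hgsum : ∀ N, 0 ≤ ∑ n ∈ Finset.range N, g n := fun N => Finset.sum_nonneg fun n _ => hg0 n
  -- Multiplied by `R`, so that the terms of the second range are compared with squares and no
  -- division occurs.
  have key : ‖∑ n ∈ Finset.range N, f n‖ * R ≤ 3 * R ^ 2 + ∑ n ∈ Finset.range N, g n := by
    induction N with
    | zero => simp; positivity
    | succ N ih =>
      by_cases hsmall : α * √(Nat.count (· ∈ S) (N + 1)) ≤ R
      · set h : ℕ → 𝕜 := fun n => if n ∈ Λ then 0 else (weight S n : 𝕜) * B.coord n z with hh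
        have hsum : ∑ n ∈ Finset.range (N + 1), f n =
            ∑ n ∈ Finset.range (N + 1), (weight S n : 𝕜) * B.coord n z -
              ∑ n ∈ Finset.range (N + 1), h n := by
          rw [← Finset.sum_sub_distrib]
          refine Finset.sum_congr rfl fun n _ => ?_
          simp only [hf, hh]
          split_ifs <;> simp
        have h1 : ‖∑ n ∈ Finset.range (N + 1), h n‖ ≤ 2 * R := by
          calc ‖∑ n ∈ Finset.range (N + 1), h n‖
              ≤ ∑ n ∈ Finset.range (N + 1), α * weight S n := by
                refine norm_sum_le_of_le _ fun n _ => ?_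
                have hw := weight_nonneg S n
                simp only [hh]
                split_ifs with hn
                · rw [norm_zero]; positivity
                · rw [norm_mul, RCLike.norm_ofReal, abs_of_nonneg hw, mul_comm]
                  gcongr
                  exact hΛ n₀ hn₀ n hn
            _ = α * ∑ n ∈ Finset.range (N + 1), weight S n := by rw [Finset.mul_sum]
            _ ≤ α * (2 * √(Nat.count (· ∈ S) (N + 1))) := by
                gcongr; exact sum_weight_le S _
            _ ≤ 2 * R := by linarith
        have h2 : ‖∑ n ∈ Finset.range (N + 1), f n‖ ≤ 3 * R := by
          rw [hsum]
          refine (norm_sub_le _ _).trans ?_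
          linarith [hB.norm_sum_weight_le z (N + 1)]
        nlinarith [hgsum (N + 1)]
      · rw [Finset.sum_range_succ, Finset.sum_range_succ]
        have hlast : ‖f N‖ * R ≤ g N := by
          by_cases hN : N ∈ Λ ∧ N ∈ S
          · have hwN : weight S N = (√(Nat.count (· ∈ S) (N + 1)))⁻¹ := by
              rw [weight, if_pos hN.2, Nat.count_succ, if_pos hN.2]
              push_cast
              rfl
            have hc : 0 < √(Nat.count (· ∈ S) (N + 1) : ℝ) := by
              rw [Nat.count_succ, if_pos hN.2]
              push_cast
              positivity
            simp only [hf, hg, if_pos hN, if_pos hN.1]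
            rw [norm_mul, RCLike.norm_ofReal, abs_of_nonneg (weight_nonneg S N), hwN]
            have h1 : (√(Nat.count (· ∈ S) (N + 1) : ℝ))⁻¹ * R ≤ ‖B.coord N z‖ := by
              rw [inv_mul_le_iff₀ hc]
              calc R ≤ α * √(Nat.count (· ∈ S) (N + 1) : ℝ) := (not_le.1 hsmall).le
                _ ≤ ‖B.coord N z‖ * √(Nat.count (· ∈ S) (N + 1) : ℝ) := by
                  gcongr; exact hmin N hN.1
                _ = _ := mul_comm _ _
            nlinarith [norm_nonneg (B.coord N z)]
          · have hfN : f N = 0 := by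
              simp only [hf]
              split_ifs with hΛN
              · rw [weight_of_notMem fun hS => hN ⟨hΛN, hS⟩]; simp
              · rfl
            rw [hfN, norm_zero, zero_mul]
            exact hg0 N
        have := mul_le_mul_of_nonneg_right (norm_add_le (∑ n ∈ Finset.range N, f n) (f N)) hz0.le
        linarith
  have hgle : ∑ n ∈ Finset.range N, g n ≤ R ^ 2 := by
    rw [hg, ← Finset.sum_filter]
    exact hB.sum_sq_le z _ fun n hn => (Finset.mem_filter.1 hn).2.2
  nlinarith

theorem norm_sub_proj_le (hB : B.IsWeightedNorm S) {z : X} {Λ : Finset ℕ}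
    (hΛ : B.IsGreedySet z Λ) : ‖z - B.proj Λ z‖ ≤ 5 * ‖z‖ := by
  linarith [norm_sub_le z (B.proj Λ z), hB.norm_proj_le_four_mul hΛ]

theorem quasiGreedy (hB : B.IsWeightedNorm S) : B.QuasiGreedy :=
  ⟨5, by norm_num, fun _ _ hΛ => hB.norm_sub_proj_le hΛ⟩

theorem tendsto_proj_range (hB : B.IsWeightedNorm S) (x : X) :
    Filter.Tendsto (fun N => B.proj (Finset.range N) x) Filter.atTop (nhds x) := by
  have hspan : ∀ z ∈ Submodule.span 𝕜 (Set.range B.vec),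
      ∃ N, ∀ M, N ≤ M → B.proj (Finset.range M) z = z := by
    intro z hz
    induction hz using Submodule.span_induction with
    | mem z hz =>
      obtain ⟨n, rfl⟩ := hz
      refine ⟨n + 1, fun M hM => ?_⟩
      have : n < M := hM
      simp [proj, B.biorthogonal, this]
    | zero => exact ⟨0, fun M _ => by simp⟩
    | add y z _ _ hy hz =>
      obtain ⟨N, hN⟩ := hy
      obtain ⟨N', hN'⟩ := hz
      refine ⟨max N N', fun M hM => ?_⟩
      conv_rhs => rw [← hN M (le_of_max_le_left hM), ← hN' M (le_of_max_le_right hM)]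
      simp [proj, add_smul, Finset.sum_add_distrib]
    | smul c y _ hy =>
      obtain ⟨N, hN⟩ := hy
      refine ⟨N, fun M hM => ?_⟩
      conv_rhs => rw [← hN M hM]
      simp [proj, mul_smul, Finset.smul_sum]
  rw [Metric.tendsto_atTop]
  intro ε hε
  obtain ⟨z, hz, hxz⟩ := Metric.mem_closure_iff.1 (B.dense_span x) (ε / 2) (half_pos hε)
  obtain ⟨N, hN⟩ := hspan z hz
  refine ⟨N, fun M hM => ?_⟩
  have h1 := hB.norm_proj_range_le (x - z) M
  have h2 : B.proj (Finset.range M) (x - z) = B.proj (Finset.range M) x - z := by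
    conv_rhs => rw [← hN M hM]
    simp [proj, sub_smul, Finset.sum_sub_distrib]
  rw [dist_eq_norm] at hxz ⊢
  calc ‖B.proj (Finset.range M) x - x‖ = ‖(B.proj (Finset.range M) x - z) - (x - z)‖ := by
        congr 1; abel
    _ ≤ ‖B.proj (Finset.range M) x - z‖ + ‖x - z‖ := norm_sub_le _ _
    _ < ε := by rw [← h2]; linarith

/-- Every `f` is the weak-* limit of `∑_{n < N} f(e_n) e_n^*`, whose value at `x` is `f` of the
`N`-th partial sum of `x`. -/
theorem isMarkushevich (hB : B.IsWeightedNorm S) : B.IsMarkushevich := by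
  intro f
  refine mem_closure_of_tendsto (b := Filter.atTop)
    (f := fun N => ∑ n ∈ Finset.range N, f (B.vec n) • StrongDual.toWeakDual (B.coord n)) ?_
    (Filter.Eventually.of_forall fun N => Submodule.sum_mem _ fun n _ =>
      Submodule.smul_mem _ _ (Submodule.subset_span ⟨n, rfl⟩))
  refine tendsto_iff_forall_eval_tendsto_topDualPairing.2 fun x => ?_
  have := ((WeakDual.toStrongDual f).continuous.tendsto x).comp (hB.tendsto_proj_range x)
  refine this.congr fun N => ?_
  change _ = WeakDual.toStrongDual
    (∑ n ∈ Finset.range N, f (B.vec n) • StrongDual.toWeakDual (B.coord n)) x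
  rw [map_sum]
  simp [proj, mul_comm]

theorem isSchauder (hB : B.IsWeightedNorm S) : B.IsSchauder :=
  ⟨hB.isMarkushevich, 1, one_pos, fun x m => by simpa using hB.norm_proj_range_le x m⟩

/-- Unconditionality would bound all projections uniformly. The vector with coefficients `± weight`,
signs alternating along `S`, has norm at most `√(1 + H)`, while its positive part has norm at least
`H / 2`. -/
theorem isConditional [CompleteSpace X] (hB : B.IsWeightedNorm S) (hS : S.Infinite) :
    B.IsConditional := by
  classical
  intro hunc
  obtain ⟨K, hK⟩ := banach_steinhaus
    (g := fun A : Finset ℕ => ∑ n ∈ A, (B.coord n).smulRight (B.vec n)) fun x => by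
      obtain ⟨C, hC⟩ := exists_norm_sum_le_of_summable (hunc x).summable
      exact ⟨C, fun A => by simpa using hC A⟩
  have hK' : ∀ A z, ‖B.proj A z‖ ≤ K * ‖z‖ := fun A z => by
    simpa [proj] using ContinuousLinearMap.le_of_opNorm_le _ (hK A) z
  -- Squaring `H / 2 ≤ K √(1 + H)` gives `H² ≤ 4 K² (1 + H)`, impossible for `H > 4 K² + 1`.
  obtain ⟨N, hN⟩ := exists_lt_sum_weight_sq hS (4 * K ^ 2 + 1)
  set H := ∑ n ∈ Finset.range N, weight S n ^ 2 with hH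
  have hH0 : 0 ≤ H := Finset.sum_nonneg fun n _ => sq_nonneg _
  set z : X := ∑ n ∈ Finset.range N, ((altSign S n * weight S n : ℝ) : 𝕜) • B.vec n with hz
  have hcz : ∀ n, B.coord n z = ((if n < N then altSign S n * weight S n else 0 : ℝ) : 𝕜) := by
    intro n
    rw [hz, B.coord_sum_smul _ (fun n => ((altSign S n * weight S n : ℝ) : 𝕜))]
    simp only [Finset.mem_range]
    split_ifs <;> simp
  have habs : ∀ n, |altSign S n * weight S n| = weight S n := fun n => by
    rcases altSign_eq_or S n with h | h <;> simp [h, abs_of_nonneg (weight_nonneg S n)]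
  have hncz : ∀ n, ‖B.coord n z‖ = if n < N then weight S n else 0 := fun n => by
    rw [hcz, RCLike.norm_ofReal]
    split_ifs
    · exact habs n
    · simp
  have hznorm : ‖z‖ ≤ √(1 + H) := by
    have h1 : 1 ≤ √(1 + H) := Real.one_le_sqrt.2 (by linarith)
    refine hB.norm_le z _ (by positivity) (fun n => ?_) (fun s _ => ?_) fun M => ?_
    · rw [hncz]
      split_ifs
      · exact (weight_le_one S n).trans h1
      · positivity
    · rw [Real.sq_sqrt (by positivity)]
      have : ∑ n ∈ s, ‖B.coord n z‖ ^ 2 = ∑ n ∈ s, if n ∈ Finset.range N then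
          weight S n ^ 2 else 0 := Finset.sum_congr rfl fun n _ => by
        rw [hncz]; simp only [Finset.mem_range]; split_ifs <;> simp
      rw [this, Finset.sum_ite_mem]
      have := Finset.sum_le_sum_of_subset_of_nonneg
        (Finset.inter_subset_right (s₁ := s) (s₂ := Finset.range N))
        (f := fun n => weight S n ^ 2) fun n _ _ => sq_nonneg _
      linarith
    · have : ∑ n ∈ Finset.range M, (weight S n : 𝕜) * B.coord n z =
          ((∑ n ∈ Finset.range (min M N), altSign S n * weight S n ^ 2 : ℝ) : 𝕜) := by
        have hmin : Finset.range (min M N) = Finset.range M ∩ Finset.range N := by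
          ext n; simp
        rw [hmin, ← Finset.sum_ite_mem]
        push_cast
        refine Finset.sum_congr rfl fun n _ => ?_
        rw [hcz]
        simp only [Finset.mem_range]
        split_ifs
        · push_cast; ring
        · simp
      rw [this, RCLike.norm_ofReal]
      have := sum_altSign_mem_Icc S (min M N)
      rw [abs_of_nonneg this.1]
      exact this.2.trans h1
  have hlow : H / 2 ≤ ‖B.proj ((Finset.range N).filter fun n => altSign S n = 1) z‖ := by
    refine le_trans ?_ (hB.norm_sum_weight_le _ N)
    have : ∑ n ∈ Finset.range N, (weight S n : 𝕜) *
        B.coord n (B.proj ((Finset.range N).filter fun n => altSign S n = 1) z) =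
        ((∑ n ∈ Finset.range N, if altSign S n = 1 then weight S n ^ 2 else 0 : ℝ) : 𝕜) := by
      push_cast
      refine Finset.sum_congr rfl fun n hn => ?_
      rw [B.coord_proj, hcz, if_pos (Finset.mem_range.1 hn)]
      by_cases h : altSign S n = 1
      · simp [h, Finset.mem_range.1 hn, pow_two]
      · simp [h]
    rw [this, RCLike.norm_ofReal]
    exact (half_sum_weight_sq_le S N).trans (le_abs_self _)
  have hfin : H / 2 ≤ K * √(1 + H) := by
    have hK0 : 0 ≤ K := (norm_nonneg _).trans (hK ∅)
    exact hlow.trans ((hK' _ z).trans (by gcongr))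
  have hsq := Real.sq_sqrt (by positivity : 0 ≤ 1 + H)
  have h1 : (H / 2) ^ 2 ≤ (K * √(1 + H)) ^ 2 := by gcongr
  rw [mul_pow, hsq] at h1
  nlinarith [sq_nonneg K]

theorem familyAlmostGreedy (hB : B.IsWeightedNorm S) {𝓕 : Set (Finset ℕ)} (h𝓕 : ∅ ∈ 𝓕)
    (hS : ∀ F ∈ 𝓕, ((F : Set ℕ) ∩ S).Subsingleton) : B.FamilyAlmostGreedy 𝓕 := by
  refine .of_forall_le (Δ := 6) h𝓕 (by norm_num) fun x Λ hΛ F hF hFc => ?_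
  rw [B.sub_proj_eq F Λ x]
  set y := x - B.proj F x with hy
  have h1 := hB.norm_sub_proj_le (hΛ.sdiff F)
  have h2 : ‖B.proj (F \ Λ) x‖ ≤ ‖y‖ := by
    refine hB.norm_proj_le_of_subsingleton ((hS F hF).anti fun n hn =>
      ⟨(Finset.mem_sdiff.1 hn.1).1, hn.2⟩) (norm_nonneg y) fun n hn => ?_
    -- As `|F| ≤ |Λ|`, an index in `F \ Λ` forces one in `Λ \ F`; its coefficient is at least as
    -- large and survives in `y`.
    obtain ⟨n₀, hn₀⟩ : (Λ \ F).Nonempty := by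
      rw [← Finset.card_pos]
      have h1 := Finset.card_pos.2 ⟨n, hn⟩
      have h2 := Finset.card_sdiff_add_card_inter F Λ
      have h3 := Finset.card_sdiff_add_card_inter Λ F
      rw [Finset.inter_comm] at h3
      omega
    obtain ⟨hn₀Λ, hn₀F⟩ := Finset.mem_sdiff.1 hn₀
    have : B.coord n₀ y = B.coord n₀ x := by simp [hy, B.coord_proj, hn₀F]
    exact (hΛ n₀ hn₀Λ n (Finset.mem_sdiff.1 hn).2).trans (this ▸ hB.norm_coord_le y n₀)
  refine (norm_add_le _ _).trans ?_
  linarith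

/-- For `A ⊆ S` and `D ⊆ Sᶜ` of size `m`, the set `D` is greedy for `1_A + 1_D`, yet `1_A` has norm
at least `√m` and `1_D` has norm at most `1`. -/
theorem not_almostGreedy (hB : B.IsWeightedNorm S) (hS : S.Infinite) (hS' : Sᶜ.Infinite) :
    ¬ B.AlmostGreedy := by
  rintro ⟨C, hC, h⟩
  have := PNormedSpace.of_normedSpace one_pos le_rfl 𝕜 X
  obtain ⟨m, hm⟩ := exists_nat_gt (C ^ 2)
  obtain ⟨A, hAS, hA⟩ := hS.exists_subset_card_eq m
  obtain ⟨D, hDS, hD⟩ := hS'.exists_subset_card_eq m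
  have hAD : Disjoint A D := Finset.disjoint_left.2 fun n hnA hnD => hDS hnD (hAS hnA)
  set x : X := ∑ n ∈ A ∪ D, (1 : 𝕜) • B.vec n with hx
  have hcx : ∀ n, B.coord n x = if n ∈ A ∪ D then 1 else 0 :=
    B.coord_sum_smul (A ∪ D) fun _ => (1 : 𝕜)
  have hxsum : x = B.proj A x + B.proj D x := by
    rw [← B.proj_union hAD]
    exact Finset.sum_congr rfl fun n hn => by rw [hcx, if_pos hn]
  have hgreedy : B.IsGreedySet x D := by
    intro n hn k _
    rw [hcx, hcx, if_pos (Finset.mem_union_right _ hn)]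
    split_ifs <;> simp
  have h1 := (h x m D hD hgreedy).trans
    (mul_le_mul_of_nonneg_left (hA ▸ PNormedSpace.projError_le 1 𝕜 B x A) hC.le)
  have e1 : x - B.proj D x = B.proj A x := sub_eq_of_eq_add hxsum
  have e2 : x - B.proj A x = B.proj D x := sub_eq_of_eq_add' hxsum
  rw [e1, e2] at h1
  have h2 : ‖B.proj D x‖ ≤ 1 := by
    refine hB.norm_proj_le_of_subsingleton (fun n hn => absurd hn.2 (hDS hn.1)) zero_le_one
      fun n hn => ?_
    rw [hcx, if_pos (Finset.mem_union_right _ hn), norm_one]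
  have h3 := hB.sum_sq_le (B.proj A x) A hAS
  have h4 : ∑ n ∈ A, ‖B.coord n (B.proj A x)‖ ^ 2 = m := by
    rw [← hA, Finset.card_eq_sum_ones, Nat.cast_sum]
    refine Finset.sum_congr rfl fun n hn => ?_
    rw [B.coord_proj, if_pos hn, hcx, if_pos (Finset.mem_union_left _ hn)]
    simp
  have h5 : ‖B.proj A x‖ ≤ C := h1.trans (mul_le_of_le_one_right hC.le h2)
  have h6 : ‖B.proj A x‖ ^ 2 ≤ C ^ 2 := by gcongr
  linarith

end GBasis.IsWeightedNorm

end WeightedNorm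

end SeqGreedy

namespace SeqGreedy

open scoped ENNReal

/-! ### Construction of the weighted Banach space. -/

section WeightedSpace

variable (𝕜 : Type) [RCLike 𝕜] (S : Set ℕ)

/-- The ambient space: coefficients, coefficients indexed by `S`, weighted partial sums. -/
abbrev WeightedAmbient : Type u :=
  lp (fun _ : ULift.{u} ℕ => 𝕜) ∞ × lp (fun _ : ℕ => 𝕜) 2 × lp (fun _ : ℕ => 𝕜) ∞

theorem memℓp_weight_tail (n : ℕ) :
    Memℓp (fun N : ℕ => if n < N then (weight S n : 𝕜) else 0) ∞ := by
  refine memℓp_infty ⟨weight S n, ?_⟩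
  rintro _ ⟨N, rfl⟩
  have h := weight_nonneg S n
  simp only
  split_ifs
  · rw [RCLike.norm_ofReal, abs_of_nonneg h]
  · simpa using h

open Classical in
/-- The vectors of the basis, in the ambient space. -/
noncomputable def ambientVec (n : ℕ) : WeightedAmbient.{u} 𝕜 :=
  (lp.single ∞ ⟨n⟩ 1, if n ∈ S then lp.single 2 n 1 else 0, ⟨_, memℓp_weight_tail 𝕜 S n⟩)

/-- The closed linear span of the vectors of the basis. -/
abbrev WeightedSpace : Type u :=
  (Submodule.span 𝕜 (Set.range (ambientVec.{u} 𝕜 S))).topologicalClosure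

/-- The coefficient functionals on the ambient space. -/
noncomputable def ambientCoord (n : ℕ) : WeightedAmbient.{u} 𝕜 →L[𝕜] 𝕜 :=
  (lp.evalCLM 𝕜 (fun _ : ULift.{u} ℕ => 𝕜) ∞ ⟨n⟩).comp
    (ContinuousLinearMap.fst 𝕜 _ _)

variable {𝕜 S}

theorem ambientCoord_apply (n : ℕ) (z : WeightedAmbient.{u} 𝕜) :
    ambientCoord 𝕜 n z = z.1 ⟨n⟩ := rfl

theorem ambientCoord_vec (m n : ℕ) :
    ambientCoord.{u} 𝕜 m (ambientVec 𝕜 S n) = if m = n then 1 else 0 := by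
  simp only [ambientCoord_apply, ambientVec, lp.single_apply, Pi.single_apply, ULift.up.injEq]

/-- Lets identities between the three components be checked on basis vectors and carried to the
closed span. -/
theorem WeightedSpace.eq_of_forall_vec {f g : WeightedAmbient.{u} 𝕜 →L[𝕜] 𝕜}
    (h : ∀ n, f (ambientVec 𝕜 S n) = g (ambientVec 𝕜 S n)) (z : WeightedSpace.{u} 𝕜 S) :
    f z = g z :=
  ContinuousLinearMap.eqOn_closure_span (s := Set.range (ambientVec.{u} 𝕜 S))
    (by rintro _ ⟨n, rfl⟩; exact h n) z.2

open Classical in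
theorem WeightedSpace.snd_fst_apply (z : WeightedSpace.{u} 𝕜 S) (n : ℕ) :
    z.1.2.1 n = if n ∈ S then ambientCoord 𝕜 n z else 0 := by
  have := eq_of_forall_vec (𝕜 := 𝕜) (S := S)
    (f := (lp.evalCLM 𝕜 (fun _ : ℕ => 𝕜) 2 n).comp
      ((ContinuousLinearMap.fst 𝕜 _ _).comp (ContinuousLinearMap.snd 𝕜 _ _)))
    (g := if n ∈ S then ambientCoord 𝕜 n else 0) (fun m => ?_) z
  · refine Eq.trans this ?_
    split_ifs <;> rfl
  · change (ambientVec 𝕜 S m).2.1 n = _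
    by_cases hn : n ∈ S
    · rw [if_pos hn, ambientCoord_vec, ambientVec]
      by_cases hm : m ∈ S
      · rw [if_pos hm, lp.single_apply, Pi.single_apply]
      · rw [if_neg hm, if_neg (by rintro rfl; exact hm hn)]
        rfl
    · rw [if_neg hn, ambientVec]
      by_cases hm : m ∈ S
      · rw [if_pos hm, lp.single_apply, Pi.single_apply, if_neg (by rintro rfl; exact hn hm)]
        rfl
      · rw [if_neg hm]
        rfl

theorem WeightedSpace.snd_snd_apply (z : WeightedSpace.{u} 𝕜 S) (N : ℕ) :
    z.1.2.2 N = ∑ n ∈ Finset.range N, (weight S n : 𝕜) * ambientCoord 𝕜 n z := by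
  have := eq_of_forall_vec (𝕜 := 𝕜) (S := S)
    (f := (lp.evalCLM 𝕜 (fun _ : ℕ => 𝕜) ∞ N).comp
      ((ContinuousLinearMap.snd 𝕜 _ _).comp (ContinuousLinearMap.snd 𝕜 _ _)))
    (g := ∑ n ∈ Finset.range N, (weight S n : 𝕜) • ambientCoord 𝕜 n) (fun m => ?_) z
  · refine Eq.trans this ?_
    simp
  · change (if m < N then (weight S m : 𝕜) else 0) = _
    simp [ambientCoord_vec]

theorem norm_ambientVec (n : ℕ) : ‖ambientVec.{u} 𝕜 S n‖ = 1 := by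
  have h1 : ‖(ambientVec.{u} 𝕜 S n).1‖ = 1 := by
    simp [ambientVec, lp.norm_single]
  have h2 : ‖(ambientVec.{u} 𝕜 S n).2.1‖ ≤ 1 := by
    unfold ambientVec
    simp only
    split_ifs
    · simp [lp.norm_single]
    · simp
  have h3 : ‖(ambientVec.{u} 𝕜 S n).2.2‖ ≤ 1 := by
    refine lp.norm_le_of_forall_le zero_le_one fun N => ?_
    change ‖if n < N then (weight S n : 𝕜) else 0‖ ≤ 1
    split_ifs
    · rw [RCLike.norm_ofReal, abs_of_nonneg (weight_nonneg S n)]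
      exact weight_le_one S n
    · simp
  rw [Prod.norm_def, Prod.norm_def, h1]
  exact max_eq_left (max_le h2 h3)

theorem norm_ambientCoord_le (n : ℕ) (z : WeightedAmbient.{u} 𝕜) :
    ‖ambientCoord 𝕜 n z‖ ≤ ‖z‖ :=
  (lp.norm_apply_le_norm ENNReal.top_ne_zero z.1 ⟨n⟩).trans (norm_fst_le z)

variable (𝕜 S)

/-- The vectors of the basis of `WeightedSpace`. -/
noncomputable def weightedVec (n : ℕ) : WeightedSpace.{u} 𝕜 S :=
  ⟨ambientVec 𝕜 S n, subset_closure (Submodule.subset_span ⟨n, rfl⟩)⟩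

theorem dense_span_weightedVec : Dense (Submodule.span 𝕜 (Set.range (weightedVec.{u} 𝕜 S)) :
    Set (WeightedSpace.{u} 𝕜 S)) := by
  intro z
  rw [Topology.IsInducing.subtypeVal.closure_eq_preimage_closure_image]
  refine closure_mono (fun y hy => ?_) z.2
  refine Submodule.span_induction (p := fun y _ => y ∈ Subtype.val ''
    (Submodule.span 𝕜 (Set.range (weightedVec.{u} 𝕜 S)) : Set (WeightedSpace.{u} 𝕜 S)))
    ?_ ⟨0, Submodule.zero_mem _, rfl⟩ ?_ ?_ hy
  · rintro _ ⟨n, rfl⟩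
    exact ⟨_, Submodule.subset_span ⟨n, rfl⟩, rfl⟩
  · rintro _ _ - - ⟨x, hx, rfl⟩ ⟨y, hy, rfl⟩
    exact ⟨x + y, Submodule.add_mem _ hx hy, rfl⟩
  · rintro c _ - ⟨x, hx, rfl⟩
    exact ⟨c • x, Submodule.smul_mem _ c hx, rfl⟩

/-- The basis of `WeightedSpace`. -/
noncomputable def weightedBasis : GBasis 𝕜 (WeightedSpace.{u} 𝕜 S) where
  vec := weightedVec 𝕜 S
  coord n := (ambientCoord 𝕜 n).comp (Submodule.subtypeL _)
  dense_span := dense_span_weightedVec 𝕜 S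
  biorthogonal m n := ambientCoord_vec (S := S) m n
  coord_unique g hg := by
    funext m
    refine ContinuousLinearMap.ext_on (dense_span_weightedVec 𝕜 S) ?_
    rintro _ ⟨n, rfl⟩
    exact (hg m n).trans (ambientCoord_vec (S := S) m n).symm
  seminormalized := by
    refine ⟨1, 1, one_pos, fun n => ⟨⟨(norm_ambientVec n).ge, (norm_ambientVec n).le⟩, ?_⟩⟩
    set f : WeightedSpace.{u} 𝕜 S →L[𝕜] 𝕜 := (ambientCoord 𝕜 n).comp (Submodule.subtypeL _)
    have hub : ∀ r ∈ {r : ℝ | ∃ x : WeightedSpace.{u} 𝕜 S, ‖x‖ ≤ 1 ∧ r = ‖f x‖}, r ≤ 1 := by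
      rintro _ ⟨x, hx, rfl⟩
      exact (norm_ambientCoord_le n x.1).trans hx
    have hmem : (1 : ℝ) ∈ {r : ℝ | ∃ x : WeightedSpace.{u} 𝕜 S, ‖x‖ ≤ 1 ∧ r = ‖f x‖} := by
      refine ⟨weightedVec 𝕜 S n, (norm_ambientVec n).le, ?_⟩
      change 1 = ‖ambientCoord 𝕜 n (ambientVec 𝕜 S n)‖
      rw [ambientCoord_vec, if_pos rfl, norm_one]
    exact ⟨le_csSup ⟨1, hub⟩ hmem, csSup_le ⟨1, hmem⟩ hub⟩

variable {𝕜 S}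

theorem weightedBasis_coord (n : ℕ) (z : WeightedSpace.{u} 𝕜 S) :
    (weightedBasis 𝕜 S).coord n z = ambientCoord 𝕜 n z := rfl

theorem weightedBasis_isWeightedNorm :
    (weightedBasis.{u} 𝕜 S).IsWeightedNorm S where
  norm_coord_le z n := norm_ambientCoord_le n z.1
  sum_sq_le z s hs := by
    have h := lp.sum_rpow_le_norm_rpow (by norm_num) z.1.2.1 s
    simp only [ENNReal.toReal_ofNat, Real.rpow_two] at h
    have h' : ‖z.1.2.1‖ ≤ ‖z‖ := (norm_fst_le z.1.2).trans (norm_snd_le z.1)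
    calc ∑ n ∈ s, ‖(weightedBasis 𝕜 S).coord n z‖ ^ 2 = ∑ n ∈ s, ‖z.1.2.1 n‖ ^ 2 :=
          Finset.sum_congr rfl fun n hn => by
            rw [WeightedSpace.snd_fst_apply, if_pos (hs n hn), weightedBasis_coord]
      _ ≤ ‖z.1.2.1‖ ^ 2 := h
      _ ≤ ‖z‖ ^ 2 := by gcongr
  norm_sum_weight_le z N := by
    have h := lp.norm_apply_le_norm ENNReal.top_ne_zero z.1.2.2 N
    rw [WeightedSpace.snd_snd_apply] at h
    exact h.trans ((norm_snd_le z.1.2).trans (norm_snd_le z.1))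
  norm_le z R hR h1 h2 h3 := by
    classical
    change ‖z.1‖ ≤ R
    rw [Prod.norm_def, Prod.norm_def]
    refine max_le (lp.norm_le_of_forall_le hR fun n => h1 n.down) (max_le ?_ ?_)
    · refine lp.norm_le_of_forall_sum_le (by norm_num) hR fun s => ?_
      simp only [ENNReal.toReal_ofNat, Real.rpow_two, WeightedSpace.snd_fst_apply]
      have := h2 (s.filter (· ∈ S)) fun n hn => (Finset.mem_filter.1 hn).2
      rw [Finset.sum_filter] at this
      refine (Finset.sum_le_sum fun n _ => ?_).trans this
      split_ifs
      · rfl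
      · simp
    · refine lp.norm_le_of_forall_le hR fun N => ?_
      rw [WeightedSpace.snd_snd_apply]
      exact h3 N

instance : CompleteSpace (WeightedSpace.{u} 𝕜 S) :=
  (Submodule.isClosed_topologicalClosure _).completeSpace_coe

instance : TopologicalSpace.SeparableSpace (WeightedSpace.{u} 𝕜 S) :=
  ((Set.countable_range _).isSeparable.span (R := 𝕜)).closure.separableSpace

end WeightedSpace

/-! ### Assembling the example and the equivalence. -/

theorem GBasis.not_finiteDimensional {𝕜 : Type v} {X : Type u} [RCLike 𝕜] [AddCommGroup X]
    [Module 𝕜 X] [UniformSpace X] [Norm X] (B : GBasis 𝕜 X) : ¬ FiniteDimensional 𝕜 X := by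
  intro hfin
  have hli : LinearIndependent 𝕜 B.vec := by
    rw [linearIndependent_iff']
    intro s g hg n hn
    have := congrArg (B.coord n) hg
    rwa [B.coord_sum_smul, if_pos hn, map_zero] at this
  have : Finite ℕ := hli.finite
  exact not_finite ℕ

theorem exists_conditional_quasiGreedy_familyAlmostGreedy (𝕜 : Type) [RCLike 𝕜] {a : ℕ → ℕ}
    (ha : ∀ n, 0 < a n) (hbdd : ¬ BddAbove (Set.range a)) :
    ∃ (X : Type u) (_ : NormedAddCommGroup X) (_ : NormedSpace 𝕜 X),
      CompleteSpace X ∧ TopologicalSpace.SeparableSpace X ∧ ¬ FiniteDimensional 𝕜 X ∧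
      ∃ B : GBasis 𝕜 X, B.IsSchauder ∧ B.IsConditional ∧ B.QuasiGreedy ∧
        B.FamilyAlmostGreedy (gapFamily a) ∧ ¬ B.AlmostGreedy := by
  obtain ⟨S, hS, hF⟩ := exists_infinite_subsingleton_inter ha hbdd
  have hS' : Sᶜ.Infinite := by
    intro hfin
    -- A member of the family has at most one point in `S`, so a finite complement would bound the
    -- sizes of the members.
    have hle : ∀ ℓ : ℕ, 1 ≤ ℓ → ℓ ≤ hfin.toFinset.card + 1 := by
      classical
      intro ℓ hℓ
      have hsub : gapSet a 0 ℓ \ hfin.toFinset = (gapSet a 0 ℓ).filter (· ∈ S) := by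
        ext n; simp
      have h1 : (gapSet a 0 ℓ \ hfin.toFinset).card ≤ 1 := by
        rw [hsub, Finset.card_le_one]
        intro m hm n hn
        rw [Finset.mem_filter] at hm hn
        exact hF _ (gapSet_mem_gapFamily a 0 hℓ) hm hn
      have h2 := Finset.le_card_sdiff hfin.toFinset (gapSet a 0 ℓ)
      rw [card_gapSet ha] at h2
      omega
    have := hle (hfin.toFinset.card + 2) (by omega)
    omega
  have hB := weightedBasis_isWeightedNorm.{u} (𝕜 := 𝕜) (S := S)
  exact ⟨WeightedSpace.{u} 𝕜 S, inferInstance, inferInstance, inferInstance, inferInstance,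
    (weightedBasis 𝕜 S).not_finiteDimensional, weightedBasis 𝕜 S, hB.isSchauder,
    hB.isConditional hS, hB.quasiGreedy, hB.familyAlmostGreedy (empty_mem_gapFamily a) hF,
    hB.not_almostGreedy hS hS'⟩

end SeqGreedy

theorem theorem2p2 (𝕜 : Type) [RCLike 𝕜] (p : ℝ) (hp_pos : 0 < p) (hp_le : p ≤ 1)
    (a : ℕ → ℕ) (ha : ∀ n, 0 < a n) :
    (BddAbove (Set.range a) ↔
      ∀ (X : Type u) [AddCommGroup X] [Module 𝕜 X] [UniformSpace X] [Norm X]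
        [PNormedSpace p 𝕜 X] [CompleteSpace X] [TopologicalSpace.SeparableSpace X],
        ¬ FiniteDimensional 𝕜 X →
        ∀ B : GBasis 𝕜 X, B.FamilyAlmostGreedy (gapFamily a) ↔ B.AlmostGreedy) ∧
    (¬ BddAbove (Set.range a) →
      ∃ (X : Type u) (_ : NormedAddCommGroup X) (_ : NormedSpace 𝕜 X),
        CompleteSpace X ∧ TopologicalSpace.SeparableSpace X ∧ ¬ FiniteDimensional 𝕜 X ∧
        ∃ B : GBasis 𝕜 X, B.IsSchauder ∧ B.IsConditional ∧ B.QuasiGreedy ∧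
          B.FamilyAlmostGreedy (gapFamily a) ∧ ¬ B.AlmostGreedy) := by
  refine ⟨⟨fun hbdd X _ _ _ _ _ _ _ _ B => ⟨fun hB => hB.almostGreedy_of_bddAbove p hp_pos ha hbdd,
    fun hB => hB.familyAlmostGreedy p hp_pos (empty_mem_gapFamily a)⟩, fun h => ?_⟩,
    exists_conditional_quasiGreedy_familyAlmostGreedy 𝕜 ha⟩
  by_contra hbdd
  obtain ⟨X, _, _, _, _, hdim, B, -, -, -, hF, hAG⟩ :=
    exists_conditional_quasiGreedy_familyAlmostGreedy.{u} 𝕜 ha hbdd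
  have := PNormedSpace.of_normedSpace hp_pos hp_le 𝕜 X
  exact hAG ((h X hdim B).1 hF)
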